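/- Let $M$ be a smooth $4$-manifold with an $\mathrm{SU}(2)$-structure, i.e. a triple $\boldsymbol\omega=(\omega_1,\omega_2,\omega_3)$ of smooth $2$-forms which at each point can be written as $\omega_1=dx_{12}+dx_{34}$, $\omega_2=dx_{13}+dx_{42}$, $\omega_3=dx_{14}+dx_{23}$ in suitable local coordinates (here $dx_{ab}=dx_a\wedge dx_b$). Let $g$ be the induced Riemannian metric and $J_1,J_2,J_3$ the induced almost complex structures, determined by $\omega_i=g(J_i\cdot,\cdot)$ and $J_iX\lrcorner\,\omega_j=-X\lrcorner\,\omega_k$ for $(i,j,k)$ a cyclic permutation of $(1,2,3)$ (so $J_1J_2=J_3$). Let $\mathrm{vol}=\frac12\omega_1\wedge\omega_1$, let $*$ be the Hodge star, $\alpha\wedge*\beta=g(\alpha,\beta)\,\mathrm{vol}$, with $g(\alpha,\beta)=\frac1{k!}g^{i_1j_1}\cdots g^{i_kj_k}\alpha_{i_1\dots i_k}\beta_{j_1\dots j_k}$ on $k$-forms, let $\nabla$ be the Levi-Civita connection of $g$, and put $J_i(\alpha)(X)=\alpha(J_iX)$ for a $1$-form $\alpha$. For $2$-tensors put $(A\diamond\alpha)_{ij}=\frac12\big(A_{ai}g^{ab}\alpha_{bj}+A_{aj}g^{ab}\alpha_{ib}\big)$.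 There is a unique tensor $T\in\Lambda^1(M)\otimes\Lambda^2_+(M)$, the intrinsic torsion, such that $\nabla_X\omega_i=T(X)\diamond\omega_i$ for all $X$ and $i=1,2,3$. It can be written uniquely as $T=a_1\otimes\omega_1+a_2\otimes\omega_2+a_3\otimes\omega_3$ with $1$-forms $a_1,a_2,a_3$, and the following hold. 1. $T=\frac12\big(g(\nabla\omega_2,\omega_3)\otimes\omega_1+g(\nabla\omega_3,\omega_1)\otimes\omega_2+g(\nabla\omega_1,\omega_2)\otimes\omega_3\big)$; equivalently, $a_i=\frac12 g(\nabla\omega_j,\omega_k)$ for every cyclic permutation $(i,j,k)$ of $(1,2,3)$. 2. The torsion forms are $$a_1=-\tfrac12\big(*d\omega_1+J_2(*d\omega_3)-J_3(*d\omega_2)\big),$$ $$a_2=-\tfrac12\big(*d\omega_2-J_1(*d\omega_3)+J_3(*d\omega_1)\big),$$ $$a_3=-\tfrac12\big(*d\omega_3+J_1(*d\omega_2)-J_2(*d\omega_1)\big).$$ 3. For every cyclic permutation $(i,j,k)$ of $(1,2,3)$, $\nabla\omega_i=0$ if and only if $a_j=a_k=0$. 4. $T=0$ if and only if $\nabla\omega_1=\nabla\omega_2=\nabla\omega_3=0$,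 if and only if $d\omega_1=d\omega_2=d\omega_3=0$. -/

import Mathlib

open scoped Manifold ContDiff

noncomputable section

namespace SUTwo

/-! ### Linear algebra on the model tangent space -/

/-- The model space `ℝ⁴` of the charts and of the tangent spaces. -/
abbrev V4 : Type := EuclideanSpace ℝ (Fin 4)

/-- The basis of coordinate vectors `∂₁, …, ∂₄`. -/
def coordVec (i : Fin 4) : V4 := EuclideanSpace.single i 1

/-- The coefficients `g^{ij}` of the inverse of a bilinear form `g`. -/
def gInv (g : V4 → V4 → ℝ) (i j : Fin 4) : ℝ :=
  (Matrix.of fun a b => g (coordVec a) (coordVec b))⁻¹ i j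

/-- The inner product of `k`-forms,
`g(α, β) = 1/k! g^{i₁j₁} ⋯ g^{iₖjₖ} α_{i₁…iₖ} β_{j₁…jₖ}`. -/
def innerForm (g : V4 → V4 → ℝ) {k : ℕ} (α β : (Fin k → V4) → ℝ) : ℝ :=
  (1 / (k.factorial : ℝ)) * ∑ i : Fin k → Fin 4, ∑ j : Fin k → Fin 4,
    (∏ m, gInv g (i m) (j m)) * α (fun m => coordVec (i m)) * β (fun m => coordVec (j m))

/-- The wedge product of a `k`-form and an `l`-form, normalised so that
`dx₁ ∧ dx₂ = dx₁ ⊗ dx₂ - dx₂ ⊗ dx₁`. -/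
def wedge {k l : ℕ} (α : (Fin k → V4) → ℝ) (β : (Fin l → V4) → ℝ) :
    (Fin (k + l) → V4) → ℝ := fun v =>
  (1 / ((k.factorial : ℝ) * (l.factorial : ℝ))) *
    ∑ σ : Equiv.Perm (Fin (k + l)), ((Equiv.Perm.sign σ : ℤ) : ℝ) *
      α (fun i => v (σ (Fin.castAdd l i))) * β (fun j => v (σ (Fin.natAdd k j)))

/-- The Hodge star of a `k`-form `β` with respect to `g` and the volume form `vol`:
`(*β)(w) = g(β, vol(·, w))`, that is
`(*β)_{b} = 1/k! g^{i₁j₁} ⋯ g^{iₖjₖ} β_{i₁…iₖ} vol_{j₁…jₖ b}`.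
It is the `l`-form with `α ∧ *β = g(α, β) vol` for all `k`-forms `α`, where `k + l = 4`. -/
def hodgeStar (g : V4 → V4 → ℝ) {k l : ℕ} (vol : (Fin (k + l) → V4) → ℝ)
    (β : (Fin k → V4) → ℝ) : (Fin l → V4) → ℝ :=
  fun w => innerForm g β (fun u => vol (Fin.append u w))

/-- The action of a `2`-tensor `A` on a `2`-tensor `α`,
`(A ⋄ α)_{ij} = ½ (A_{ai} g^{ab} α_{bj} + A_{aj} g^{ab} α_{ib})`. -/
def diamond (g : V4 → V4 → ℝ) (A α : (Fin 2 → V4) → ℝ) : (Fin 2 → V4) → ℝ := fun v =>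
  (1 / 2) * ∑ a, ∑ b, gInv g a b *
    (A ![coordVec a, v 0] * α ![coordVec b, v 1] + A ![coordVec a, v 1] * α ![v 0, coordVec b])

/-- The `2`-form `dx_a ∧ dx_b` on `ℝ⁴` (with `a, b` counted from `0`). -/
def dxdx (a b : Fin 4) (v w : V4) : ℝ := v a * w b - v b * w a

/-- The model triple `dx₁₂ + dx₃₄`, `dx₁₃ + dx₄₂`, `dx₁₄ + dx₂₃` on `ℝ⁴`. -/
def stdForm : Fin 3 → V4 → V4 → ℝ :=
  ![fun v w => dxdx 0 1 v w + dxdx 2 3 v w,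
    fun v w => dxdx 0 2 v w + dxdx 3 1 v w,
    fun v w => dxdx 0 3 v w + dxdx 1 2 v w]

/-- The endomorphism `J_i` of a triple `(ω₁, ω₂, ω₃)`, determined by
`J_i X ⌟ ω_j = - X ⌟ ω_k` for `(i, j, k)` cyclic (indices in `Fin 3`, so `j = i + 1`, `k = i + 2`).
With this sign, `ω_i = g(J_i ·, ·)` for a positive definite `g` and `J₁ J₂ = J₃`. -/
def cplx (w : Fin 3 → V4 [⋀^Fin 2]→L[ℝ] ℝ) (i : Fin 3) : V4 →L[ℝ] V4 :=
  -((w (i + 1)).curryLeft.inverse.comp (w (i + 2)).curryLeft)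

/-- The metric of a triple: `g(X, Y) = -ω₁(J₁ X, Y)`, so that `ω₁ = g(J₁ ·, ·)`. -/
def metricOf (w : Fin 3 → V4 [⋀^Fin 2]→L[ℝ] ℝ) (X Y : V4) : ℝ :=
  -(w 0 ![cplx w 0 X, Y])

/-- The volume form of a triple: `vol = ½ ω₁ ∧ ω₁`. -/
def volOf (w : Fin 3 → V4 [⋀^Fin 2]→L[ℝ] ℝ) : (Fin (2 + 2) → V4) → ℝ :=
  fun v => (1 / 2) * wedge (fun u => w 0 u) (fun u => w 0 u) v

/-- The vector `Γ(v, u)` with components `Γ^k_{ij} v^i u^j` at the point `y` of a chart, for the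
Christoffel symbols `Γ^k_{ij} = ½ g^{kl} (∂_i g_{jl} + ∂_j g_{il} - ∂_l g_{ij})` of a metric `g`
on (an open subset of) `ℝ⁴`. -/
def christoffel (g : V4 → V4 → V4 → ℝ) (y v u : V4) : V4 :=
  ∑ k, ∑ l, ((1 / 2) * gInv (g y) k l *
    (fderiv ℝ (fun z => g z u (coordVec l)) y v
      + fderiv ℝ (fun z => g z v (coordVec l)) y u
      - fderiv ℝ (fun z => g z v u) y (coordVec l))) • coordVec k

/-! ### Forms on a `4`-manifold -/

section Manifold

variable {M : Type*} [TopologicalSpace M] [ChartedSpace V4 M]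

/-- The expression of a `k`-form `η` in the chart at `x₀`: the pullback of `η` under the inverse
of the chart. -/
def inChart {k : ℕ} (η : (x : M) → TangentSpace (𝓡 4) x [⋀^Fin k]→L[ℝ] ℝ) (x₀ : M) (y : V4) :
    V4 [⋀^Fin k]→L[ℝ] ℝ :=
  (η ((extChartAt (𝓡 4) x₀).symm y)).compContinuousLinearMap
    (mfderiv (𝓡 4) (𝓡 4) (extChartAt (𝓡 4) x₀).symm y)

/-- A `k`-form on `M` is smooth if it has smooth coefficients in the charts. -/
def IsSmoothForm {k : ℕ} (η : (x : M) → TangentSpace (𝓡 4) x [⋀^Fin k]→L[ℝ] ℝ) : Prop :=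
  ∀ x₀ : M, ContDiffOn ℝ ∞ (inChart η x₀) (extChartAt (𝓡 4) x₀).target

/-- The exterior derivative of a `k`-form on `M`, computed at `x` in the chart at `x`. -/
def extD {k : ℕ} (η : (x : M) → TangentSpace (𝓡 4) x [⋀^Fin k]→L[ℝ] ℝ) (x : M) :
    TangentSpace (𝓡 4) x [⋀^Fin (k + 1)]→L[ℝ] ℝ :=
  (extDeriv (inChart η x) (extChartAt (𝓡 4) x x)).compContinuousLinearMap
    (mfderiv (𝓡 4) (𝓡 4) (extChartAt (𝓡 4) x) x)

end Manifold

/-- An `SU(2)`-structure on a `4`-manifold `M`: a triple of smooth `2`-forms which at each point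
takes the model form in a suitable linear coframe of the tangent space (equivalently, in suitable
local coordinates, at that point). -/
structure SU2Structure (M : Type*) [TopologicalSpace M] [ChartedSpace V4 M] where
  form : Fin 3 → (x : M) → TangentSpace (𝓡 4) x [⋀^Fin 2]→L[ℝ] ℝ
  smooth : ∀ i, IsSmoothForm (form i)
  adapted : ∀ x : M, ∃ e : TangentSpace (𝓡 4) x ≃ₗ[ℝ] V4,
    ∀ i X Y, form i x ![X, Y] = stdForm i (e X) (e Y)

namespace SU2Structure

variable {M : Type*} [TopologicalSpace M] [ChartedSpace V4 M] (S : SU2Structure M)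

/-- The triple at a point, on the model tangent space. -/
def at' (x : M) : Fin 3 → V4 [⋀^Fin 2]→L[ℝ] ℝ := fun i => S.form i x

/-- The almost complex structures `J₁, J₂, J₃`. -/
def J (i : Fin 3) (x : M) : TangentSpace (𝓡 4) x →L[ℝ] TangentSpace (𝓡 4) x :=
  cplx (S.at' x) i

/-- The Riemannian metric `g`. -/
def metric (x : M) (X Y : TangentSpace (𝓡 4) x) : ℝ := metricOf (S.at' x) X Y

/-- The Hodge star of a `2`-form at `x`. -/
def starTwo (x : M) (β : TangentSpace (𝓡 4) x [⋀^Fin 2]→L[ℝ] ℝ) :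
    (Fin 2 → TangentSpace (𝓡 4) x) → ℝ :=
  hodgeStar (k := 2) (l := 2) (S.metric x) (volOf (S.at' x)) β

/-- The Hodge star of a `3`-form at `x`, a `1`-form. -/
def starThree (x : M) (β : TangentSpace (𝓡 4) x [⋀^Fin 3]→L[ℝ] ℝ)
    (X : TangentSpace (𝓡 4) x) : ℝ :=
  hodgeStar (k := 3) (l := 1) (S.metric x) (volOf (S.at' x)) β ![X]

/-- The `1`-form `* dω_i`. -/
def starD (i : Fin 3) (x : M) (X : TangentSpace (𝓡 4) x) : ℝ :=
  S.starThree x (extD (S.form i) x) X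

/-- The action of `J_i` on `1`-forms, `J_i(α)(X) = α(J_i X)`. -/
def JForm (i : Fin 3) (α : (x : M) → TangentSpace (𝓡 4) x → ℝ) (x : M)
    (X : TangentSpace (𝓡 4) x) : ℝ :=
  α x (S.J i x X)

/-- The expression of the metric in the chart at `x₀`. -/
def metricInChart (x₀ : M) (y v u : V4) : ℝ :=
  S.metric ((extChartAt (𝓡 4) x₀).symm y)
    (mfderiv (𝓡 4) (𝓡 4) (extChartAt (𝓡 4) x₀).symm y v)
    (mfderiv (𝓡 4) (𝓡 4) (extChartAt (𝓡 4) x₀).symm y u)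

/-- The Levi-Civita covariant derivative `(∇_X η)(Y, Z)` of a `2`-form, computed at `x` in the
chart at `x`: in coordinates, `∇_c η_{ab} = ∂_c η_{ab} - Γ^d_{ca} η_{db} - Γ^d_{cb} η_{ad}`. -/
def nabla (η : (x : M) → TangentSpace (𝓡 4) x [⋀^Fin 2]→L[ℝ] ℝ) (x : M)
    (X : TangentSpace (𝓡 4) x) (v : Fin 2 → TangentSpace (𝓡 4) x) : ℝ :=
  let y : V4 := extChartAt (𝓡 4) x x
  let D : TangentSpace (𝓡 4) x →L[ℝ] V4 := mfderiv (𝓡 4) (𝓡 4) (extChartAt (𝓡 4) x) x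
  let Γ : V4 → V4 → V4 := christoffel (S.metricInChart x) y
  fderiv ℝ (inChart η x) y (D X) ![D (v 0), D (v 1)]
    - inChart η x y ![Γ (D X) (D (v 0)), D (v 1)]
    - inChart η x y ![D (v 0), Γ (D X) (D (v 1))]

/-- `T` is the intrinsic torsion tensor: the section of `Λ¹ ⊗ Λ²₊` (that is, `T(X)` is a self-dual
`2`-form for each `X`) with `∇_X ω_i = T(X) ⋄ ω_i` for all `X` and `i = 1, 2, 3`. -/
def IsIntrinsicTorsion
    (T : (x : M) → TangentSpace (𝓡 4) x →L[ℝ] TangentSpace (𝓡 4) x [⋀^Fin 2]→L[ℝ] ℝ) : Prop :=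
  (∀ x X v, S.starTwo x (T x X) v = T x X v) ∧
  ∀ i x X v, S.nabla (S.form i) x X v = diamond (S.metric x) (T x X) (S.form i x) v

/-- The `1`-form `g(∇ω_i, ω_j)`. -/
def innerNabla (i j : Fin 3) (x : M) (X : TangentSpace (𝓡 4) x) : ℝ :=
  innerForm (k := 2) (S.metric x) (S.nabla (S.form i) x X) (S.form j x)

end SU2Structure

end SUTwo

end

noncomputable section

namespace SUTwo

open Filter Topology

/-! At each point there is a frame in which the three forms have the constant matrices `stdMat`.
Such a frame is orthonormal for the induced metric, and the `J_i` satisfy the quaternion relations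
(`AdaptedFrame.cplx_cplx_next`, `AdaptedFrame.cplx_anticomm`). Pointwise claims thus become finite
matrix identities.

The only differential input about `∇ω_i` is the derivative of the Clifford relations `J_i J_j + J_j
J_i = -2 δ_ij`, with `∇g = 0` (`covD_clifford`). The relations with `i = j` make `∇_X ω_i`
anti-invariant under `J_i`, hence a combination of the other two forms; those with `i ≠ j` make the
coefficient matrix skew. So there are `1`-forms `c_i` with `∇ω_i = c_k ⊗ ω_j - c_j ⊗ ω_k` for cyclic
`(i, j, k)` (`exists_torsion_forms`).

Since `ω_i ⋄ ω_j = ½ g([J_i, J_j] ·, ·)`, this is exactly `(∑ c_l ω_l) ⋄ ω_i`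
(`AdaptedFrame.diamond_sum`). Self-dual forms are the span of the `ω_l`, so `T = ∑ c_l ⊗ ω_l` is
forced, and pairing with `ω_j` gives the formula in `∇ω`.

The connection is torsion-free, so `dω_i` is the cyclic sum of `∇ω_i`, that is `c_k ∧ ω_j - c_j ∧
ω_k`. With `*(α ∧ ω_j) = -J_j α` (`AdaptedFrame.starThree_eq`) this gives `*dω_i = J_k c_j - J_j
c_k`; the quaternion relations invert this system, so `dω = 0` forces `T = 0`. -/

/-! ### Adapted frames and the quaternion relations -/

/-- A `2`-form as a bilinear map, depending linearly on the form. -/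
def formBilin : (V4 [⋀^Fin 2]→L[ℝ] ℝ) →L[ℝ] V4 →L[ℝ] V4 →L[ℝ] ℝ :=
  (ContinuousLinearMap.compL ℝ V4 (V4 [⋀^Fin 1]→L[ℝ] ℝ) (V4 →L[ℝ] ℝ)
    ((ContinuousAlternatingMap.ofSubsingletonLIE (𝕜 := ℝ) (E := V4) (F := ℝ) (0 : Fin 1)).symm.toContinuousLinearEquiv :
      (V4 [⋀^Fin 1]→L[ℝ] ℝ) →L[ℝ] (V4 →L[ℝ] ℝ))).comp
    (ContinuousAlternatingMap.curryLeftLI (𝕜 := ℝ) (E := V4) (F := ℝ)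
      (n := 1)).toContinuousLinearMap

lemma formBilin_apply (α : V4 [⋀^Fin 2]→L[ℝ] ℝ) (u v : V4) :
    formBilin α u v = α ![u, v] := by
  change α (Matrix.vecCons u (fun _ => v)) = _
  congr 1
  ext i
  fin_cases i <;> rfl

/-- The matrices of the model triple. -/
def stdMat : Fin 3 → Fin 4 → Fin 4 → ℝ :=
  ![![![0, 1, 0, 0], ![-1, 0, 0, 0], ![0, 0, 0, 1], ![0, 0, -1, 0]],
    ![![0, 0, 1, 0], ![0, 0, 0, -1], ![-1, 0, 0, 0], ![0, 1, 0, 0]],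
    ![![0, 0, 0, 1], ![0, 0, 1, 0], ![0, -1, 0, 0], ![-1, 0, 0, 0]]]

/-- A frame in which a triple of `2`-forms takes the model form. -/
def AdaptedFrame (w : Fin 3 → V4 [⋀^Fin 2]→L[ℝ] ℝ) (b : Module.Basis (Fin 4) ℝ V4) : Prop :=
  ∀ i p q, formBilin (w i) (b p) (b q) = stdMat i p q

lemma exists_adaptedFrame {w : Fin 3 → V4 [⋀^Fin 2]→L[ℝ] ℝ}
    (h : ∃ e : V4 ≃ₗ[ℝ] V4, ∀ i X Y, w i ![X, Y] = stdForm i (e X) (e Y)) :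
    ∃ b, AdaptedFrame w b := by
  obtain ⟨e, he⟩ := h
  refine ⟨(EuclideanSpace.basisFun (Fin 4) ℝ).toBasis.map e.symm, fun i p q => ?_⟩
  rw [formBilin_apply, he]
  fin_cases i <;> fin_cases p <;> fin_cases q <;> simp [stdForm, dxdx, stdMat]

variable {w : Fin 3 → V4 [⋀^Fin 2]→L[ℝ] ℝ} {b : Module.Basis (Fin 4) ℝ V4}

lemma bilin_ext_basis (b : Module.Basis (Fin 4) ℝ V4) {B C : V4 →L[ℝ] V4 →L[ℝ] ℝ}
    (h : ∀ p q, B (b p) (b q) = C (b p) (b q)) : B = C := by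
  have : ∀ p, B (b p) = C (b p) := fun p =>
    ContinuousLinearMap.coe_injective (b.ext fun q => h p q)
  exact ContinuousLinearMap.coe_injective (b.ext this)

lemma formBilin_antisymm (α : V4 [⋀^Fin 2]→L[ℝ] ℝ) (u v : V4) :
    formBilin α u v = -formBilin α v u := by
  have h0 : ∀ u, formBilin α u u = 0 := fun u => by
    rw [formBilin_apply]
    exact α.map_eq_zero_of_eq _ (i := 0) (j := 1) (by simp) (by simp)
  have h := h0 (u + v)
  simp only [map_add, add_apply, h0] at h
  linarith

lemma curryLeft_apply_eq_iff (α β : V4 [⋀^Fin 2]→L[ℝ] ℝ) (u v : V4) :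
    α.curryLeft u = β.curryLeft v ↔ formBilin α u = formBilin β v :=
  ((ContinuousAlternatingMap.ofSubsingletonLIE (𝕜 := ℝ) (E := V4) (F := ℝ)
    (0 : Fin 1)).symm.injective.eq_iff).symm

lemma clm_ext_basis (b : Module.Basis (Fin 4) ℝ V4) {B C : V4 →L[ℝ] ℝ}
    (h : ∀ q, B (b q) = C (b q)) : B = C :=
  ContinuousLinearMap.coe_injective (b.ext h)

/-- The endomorphism with the matrix of a model form in a frame. -/
def frameJ (b : Module.Basis (Fin 4) ℝ V4) (i : Fin 3) : V4 →L[ℝ] V4 :=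
  LinearMap.toContinuousLinearMap (b.constr ℝ fun p => ∑ q, stdMat i p q • b q)

lemma frameJ_basis (b : Module.Basis (Fin 4) ℝ V4) (i : Fin 3) (p : Fin 4) :
    frameJ b i (b p) = ∑ q, stdMat i p q • b q := by
  simp [frameJ]

lemma stdMat_mul_self (i : Fin 3) (p q : Fin 4) :
    ∑ r, stdMat i p r * stdMat i r q = if p = q then -1 else 0 := by
  fin_cases i <;> fin_cases p <;> fin_cases q <;> simp [stdMat, Fin.sum_univ_four]

/-- Row `p` of `stdMat i` holds the coefficients of `J_i (b p)`, so composing endomorphisms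
multiplies these matrices in the opposite order. This is why the minus sign sits here although `J_i
J_{i+1} = J_{i+2}`. -/
lemma stdMat_mul_next (i : Fin 3) (p q : Fin 4) :
    ∑ r, stdMat i p r * stdMat (i + 1) r q = -stdMat (i + 2) p q := by
  fin_cases i <;> fin_cases p <;> fin_cases q <;> simp [stdMat, Fin.sum_univ_four]

lemma stdMat_next_mul (i : Fin 3) (p q : Fin 4) :
    ∑ r, stdMat (i + 1) p r * stdMat i r q = stdMat (i + 2) p q := by
  fin_cases i <;> fin_cases p <;> fin_cases q <;> simp [stdMat, Fin.sum_univ_four]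

/-- The vectors `-J_i (b p)` are dual to `b` under `ω_i`. Invertibility is what gives `inverse` in
`cplx` its meaning, as it defaults to zero otherwise. -/
lemma AdaptedFrame.isInvertible_curryLeft (hb : AdaptedFrame w b) (i : Fin 3) :
    (w i).curryLeft.IsInvertible := by
  have hJ : ∀ p q, formBilin (w i) (frameJ b i (b p)) (b q) = if p = q then -1 else 0 := by
    intro p q
    rw [← stdMat_mul_self i, frameJ_basis]
    simp [hb i _ q]
  have hinj : Function.Injective (w i).curryLeft := by
    rw [injective_iff_map_eq_zero]
    intro u hu
    have hu' : formBilin (w i) u = 0 := by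
      have := (curryLeft_apply_eq_iff (w i) (w i) u 0).1 (by rw [hu, map_zero])
      rwa [map_zero] at this
    apply b.ext_elem
    intro q
    have h2 : formBilin (w i) u (frameJ b i (b q)) = 0 := by rw [hu']; rfl
    rw [formBilin_antisymm, ← b.sum_repr u] at h2
    simpa [-Module.Basis.sum_repr, hJ] using h2
  have hsurj : Function.Surjective (w i).curryLeft := by
    intro φ
    let φ' : V4 →L[ℝ] ℝ := (ContinuousAlternatingMap.ofSubsingletonLIE (𝕜 := ℝ) (E := V4) (F := ℝ)
      (0 : Fin 1)).symm φ
    refine ⟨-∑ p, φ' (b p) • frameJ b i (b p), ?_⟩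
    apply (ContinuousAlternatingMap.ofSubsingletonLIE (𝕜 := ℝ) (E := V4) (F := ℝ)
      (0 : Fin 1)).symm.injective
    change formBilin (w i) _ = φ'
    refine clm_ext_basis b fun q => ?_
    simp [hJ]
  exact ⟨ContinuousLinearEquiv.ofBijective _ (LinearMap.ker_eq_bot.2 hinj)
    (LinearMap.range_eq_top.2 hsurj), ContinuousLinearEquiv.coe_ofBijective _ _ _⟩

lemma AdaptedFrame.cplx_basis (hb : AdaptedFrame w b) (i : Fin 3) (p : Fin 4) :
    cplx w i (b p) = ∑ q, stdMat i p q • b q := by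
  rw [cplx, neg_apply, neg_eq_iff_eq_neg, ContinuousLinearMap.comp_apply,
    (hb.isInvertible_curryLeft _).inverse_apply_eq, curryLeft_apply_eq_iff]
  refine clm_ext_basis b fun q => ?_
  have := stdMat_mul_next i p q
  rw [hb, map_neg, map_sum, neg_apply, sum_apply]
  simp [hb _ _ q, this]

lemma AdaptedFrame.cplx_eq (hb : AdaptedFrame w b) (i : Fin 3) : cplx w i = frameJ b i :=
  ContinuousLinearMap.coe_injective (b.ext fun p => (hb.cplx_basis i p).trans
    (frameJ_basis b i p).symm)

/-- The metric of a triple as a bilinear map. -/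
def metricBilin (w : Fin 3 → V4 [⋀^Fin 2]→L[ℝ] ℝ) : V4 →L[ℝ] V4 →L[ℝ] ℝ :=
  -(formBilin (w 0)).comp (cplx w 0)

lemma metricBilin_apply (w : Fin 3 → V4 [⋀^Fin 2]→L[ℝ] ℝ) (u v : V4) :
    metricBilin w u v = metricOf w u v := by
  simp [metricBilin, metricOf, formBilin_apply]

lemma AdaptedFrame.metric_basis (hb : AdaptedFrame w b) (p q : Fin 4) :
    metricBilin w (b p) (b q) = if p = q then 1 else 0 := by
  have := stdMat_mul_self 0 p q
  simp only [metricBilin, neg_apply, ContinuousLinearMap.comp_apply, hb.cplx_basis]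
  simp [hb _ _ q, this, apply_ite]

lemma AdaptedFrame.metric_apply (hb : AdaptedFrame w b) (u v : V4) :
    metricBilin w u v = ∑ p, b.repr u p * b.repr v p := by
  conv_lhs => rw [← b.sum_repr u, ← b.sum_repr v]
  simp [-Module.Basis.sum_repr, hb.metric_basis, mul_comm]

lemma AdaptedFrame.metric_symm (hb : AdaptedFrame w b) (u v : V4) :
    metricBilin w u v = metricBilin w v u := by
  simp only [hb.metric_apply, mul_comm]

lemma AdaptedFrame.metric_sum_smul (hb : AdaptedFrame w b) (u : V4) :
    ∑ p, metricBilin w u (b p) • b p = u := by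
  conv_rhs => rw [← b.sum_repr u]
  simp [-Module.Basis.sum_repr, hb.metric_apply, Finsupp.single_apply]

lemma AdaptedFrame.metric_cplx (hb : AdaptedFrame w b) (i : Fin 3) (u v : V4) :
    metricBilin w (cplx w i u) v = formBilin (w i) u v := by
  have : (metricBilin w).comp (cplx w i) = formBilin (w i) :=
    bilin_ext_basis b fun p q => by
      rw [ContinuousLinearMap.comp_apply, hb.cplx_basis, hb]
      simp [hb.metric_basis]
  rw [← this]; rfl

lemma AdaptedFrame.metric_cplx_right (hb : AdaptedFrame w b) (i : Fin 3) (u v : V4) :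
    metricBilin w u (cplx w i v) = -formBilin (w i) u v := by
  rw [hb.metric_symm, hb.metric_cplx, formBilin_antisymm]

lemma frameJ_comp_basis (b : Module.Basis (Fin 4) ℝ V4) (i j : Fin 3) (p : Fin 4) :
    frameJ b i (frameJ b j (b p)) = ∑ q, (∑ r, stdMat j p r * stdMat i r q) • b q := by
  simp only [frameJ_basis, map_sum, map_smul, Finset.smul_sum, Finset.sum_smul, mul_smul]
  exact Finset.sum_comm

lemma AdaptedFrame.cplx_cplx_self (hb : AdaptedFrame w b) (i : Fin 3) (u : V4) :
    cplx w i (cplx w i u) = -u := by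
  have : (cplx w i).comp (cplx w i) = -ContinuousLinearMap.id ℝ V4 :=
    ContinuousLinearMap.coe_injective <| b.ext fun p => by
      change cplx w i (cplx w i (b p)) = -b p
      simp [hb.cplx_eq, frameJ_comp_basis, stdMat_mul_self]
  exact congrArg (fun f => f u) this

lemma AdaptedFrame.cplx_cplx_next (hb : AdaptedFrame w b) (i : Fin 3) (u : V4) :
    cplx w i (cplx w (i + 1) u) = cplx w (i + 2) u := by
  have : (cplx w i).comp (cplx w (i + 1)) = cplx w (i + 2) :=
    ContinuousLinearMap.coe_injective <| b.ext fun p => by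
      change cplx w i (cplx w (i + 1) (b p)) = cplx w (i + 2) (b p)
      simp only [hb.cplx_eq, frameJ_comp_basis, stdMat_next_mul]
      simp [frameJ_basis]
  exact congrArg (fun f => f u) this

lemma AdaptedFrame.cplx_next_cplx (hb : AdaptedFrame w b) (i : Fin 3) (u : V4) :
    cplx w (i + 1) (cplx w i u) = -cplx w (i + 2) u := by
  have : (cplx w (i + 1)).comp (cplx w i) = -cplx w (i + 2) :=
    ContinuousLinearMap.coe_injective <| b.ext fun p => by
      change cplx w (i + 1) (cplx w i (b p)) = -cplx w (i + 2) (b p)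
      simp only [hb.cplx_eq, frameJ_comp_basis, stdMat_mul_next]
      simp [frameJ_basis]
  exact congrArg (fun f => f u) this

lemma AdaptedFrame.cplx_anticomm (hb : AdaptedFrame w b) (i j : Fin 3) (u : V4) :
    cplx w i (cplx w j u) + cplx w j (cplx w i u) = (if i = j then -2 else 0 : ℝ) • u := by
  have h : j = i ∨ j = i + 1 ∨ i = j + 1 := by revert i j; decide
  rcases h with rfl | rfl | rfl
  · simp [hb.cplx_cplx_self, two_smul]
  · simp [hb.cplx_cplx_next, hb.cplx_next_cplx]
  · simp [hb.cplx_cplx_next, hb.cplx_next_cplx]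

/-! ### Index contractions as sums over an orthonormal frame -/

lemma sum_smul_coordVec (u : V4) : ∑ i, u i • coordVec i = u := by
  ext j
  simp [coordVec, Finset.sum_apply, Pi.single_apply]

/-- With the frame vectors as columns of `Q` and `P = Q⁻¹`, the Gram matrix of the coordinate
vectors is `Pᵀ P`, whose inverse is `Q Qᵀ`. -/
lemma AdaptedFrame.gInv_eq (hb : AdaptedFrame w b) (i j : Fin 4) :
    gInv (metricOf w) i j = ∑ c, b c i * b c j := by
  let Q : Matrix (Fin 4) (Fin 4) ℝ := Matrix.of fun i c => b c i
  let P : Matrix (Fin 4) (Fin 4) ℝ := Matrix.of fun c i => b.repr (coordVec i) c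
  have hQP : Q * P = 1 := by
    ext i j
    have := congrArg (fun v : V4 => v i) (b.sum_repr (coordVec j))
    rw [Matrix.mul_apply]
    simpa [-Module.Basis.sum_repr, Q, P, Matrix.one_apply, mul_comm, coordVec, Pi.single_apply]
      using this
  have hPQ : P * Q = 1 := mul_eq_one_comm.1 hQP
  have hG : (Matrix.of fun i j => metricOf w (coordVec i) (coordVec j)) = P.transpose * P := by
    ext i j
    simp [← metricBilin_apply, hb.metric_apply, P, Matrix.mul_apply]
  have hinv : (P.transpose * P)⁻¹ = Q * Q.transpose := by
    apply Matrix.inv_eq_right_inv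
    rw [Matrix.mul_assoc, ← Matrix.mul_assoc P, hPQ, Matrix.one_mul, ← Matrix.transpose_mul, hQP,
      Matrix.transpose_one]
  rw [gInv, hG, hinv]
  simp [Q, Matrix.mul_apply]

lemma AdaptedFrame.sum_gInv_mul (hb : AdaptedFrame w b) (B : V4 →ₗ[ℝ] V4 →ₗ[ℝ] ℝ) :
    ∑ i, ∑ j, gInv (metricOf w) i j * B (coordVec i) (coordVec j) = ∑ c, B (b c) (b c) := by
  have h : ∀ c, B (b c) (b c) = ∑ i, ∑ j, b c i * b c j * B (coordVec i) (coordVec j) := by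
    intro c
    conv_lhs => rw [← sum_smul_coordVec (b c)]
    simp only [map_sum, map_smul, LinearMap.sum_apply, LinearMap.smul_apply, smul_eq_mul,
      Finset.mul_sum, mul_assoc]
    rw [Finset.sum_comm]
    refine Finset.sum_congr rfl fun i _ => Finset.sum_congr rfl fun j _ => ?_
    ring
  simp only [h, hb.gInv_eq, Finset.sum_mul]
  rw [Finset.sum_comm]
  conv_rhs => rw [Finset.sum_comm]; enter [2, i]; rw [Finset.sum_comm]
  exact Finset.sum_comm

lemma AdaptedFrame.innerForm_eq (hb : AdaptedFrame w b) {k : ℕ}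
    (α β : MultilinearMap ℝ (fun _ : Fin k => V4) ℝ) :
    innerForm (metricOf w) α β = (1 / (k.factorial : ℝ)) *
      ∑ c : Fin k → Fin 4, α (fun m => b (c m)) * β (fun m => b (c m)) := by
  have h : ∀ (γ : MultilinearMap ℝ (fun _ : Fin k => V4) ℝ) (c : Fin k → Fin 4),
      γ (fun m => b (c m)) = ∑ i : Fin k → Fin 4, (∏ m, b (c m) (i m)) *
        γ (fun m => coordVec (i m)) := by
    intro γ c
    conv_lhs => enter [2, m]; rw [← sum_smul_coordVec (b (c m))]
    rw [γ.map_sum]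
    simp [MultilinearMap.map_smul_univ]
  rw [innerForm]
  congr 1
  simp only [h, hb.gInv_eq, Finset.prod_univ_sum, Fintype.piFinset_univ, Finset.sum_mul_sum,
    Finset.prod_mul_distrib]
  simp only [Finset.sum_mul]
  conv_rhs => rw [Finset.sum_comm]; enter [2, i]; rw [Finset.sum_comm]
  refine Finset.sum_congr rfl fun i _ => Finset.sum_congr rfl fun j _ =>
    Finset.sum_congr rfl fun c _ => ?_
  ring

/-! ### The volume form and the Hodge star in a frame -/

/-- The product of two multilinear forms, evaluated on a concatenated tuple. -/
def tensorForm {k l : ℕ} (α : MultilinearMap ℝ (fun _ : Fin k => V4) ℝ)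
    (β : MultilinearMap ℝ (fun _ : Fin l => V4) ℝ) :
    MultilinearMap ℝ (fun _ : Fin (k + l) => V4) ℝ :=
  ((LinearMap.mul' ℝ ℝ).compMultilinearMap (α.domCoprod β)).domDomCongr finSumFinEquiv

lemma tensorForm_apply {k l : ℕ} (α : MultilinearMap ℝ (fun _ : Fin k => V4) ℝ)
    (β : MultilinearMap ℝ (fun _ : Fin l => V4) ℝ) (v : Fin (k + l) → V4) :
    tensorForm α β v = α (fun i => v (Fin.castAdd l i)) * β (fun j => v (Fin.natAdd k j)) := by
  simp [tensorForm]

/-- The wedge product of multilinear forms as a multilinear form. -/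
def wedgeForm {k l : ℕ} (α : MultilinearMap ℝ (fun _ : Fin k => V4) ℝ)
    (β : MultilinearMap ℝ (fun _ : Fin l => V4) ℝ) :
    MultilinearMap ℝ (fun _ : Fin (k + l) => V4) ℝ :=
  (1 / ((k.factorial : ℝ) * (l.factorial : ℝ))) • ∑ σ : Equiv.Perm (Fin (k + l)),
    ((Equiv.Perm.sign σ : ℤ) : ℝ) • (tensorForm α β).domDomCongr σ

lemma wedgeForm_apply {k l : ℕ} (α : MultilinearMap ℝ (fun _ : Fin k => V4) ℝ)
    (β : MultilinearMap ℝ (fun _ : Fin l => V4) ℝ) (v : Fin (k + l) → V4) :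
    wedgeForm α β v = wedge α β v := by
  simp [wedgeForm, wedge, tensorForm_apply, mul_assoc]

/-- The last arguments of a multilinear form, fixed. -/
def fixLast {k l : ℕ} (α : MultilinearMap ℝ (fun _ : Fin (k + l) => V4) ℝ) (u : Fin l → V4) :
    MultilinearMap ℝ (fun _ : Fin k => V4) ℝ :=
  ((α.domDomCongr finSumFinEquiv.symm).domDomCongr (Equiv.sumComm _ _)).currySum u

lemma fixLast_apply {k l : ℕ} (α : MultilinearMap ℝ (fun _ : Fin (k + l) => V4) ℝ)
    (u : Fin l → V4) (v : Fin k → V4) : fixLast α u v = α (Fin.append v u) := by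
  simp only [fixLast, MultilinearMap.currySum_apply, MultilinearMap.domDomCongr_apply]
  congr 1
  ext i
  refine Fin.addCases (fun i => ?_) (fun i => ?_) i <;> simp

lemma AdaptedFrame.hodgeStar_eq (hb : AdaptedFrame w b) {k l : ℕ}
    {vol : (Fin (k + l) → V4) → ℝ} (volM : MultilinearMap ℝ (fun _ : Fin (k + l) => V4) ℝ)
    (hvol : ∀ v, volM v = vol v) (β : MultilinearMap ℝ (fun _ : Fin k => V4) ℝ)
    (u : Fin l → V4) :
    hodgeStar (metricOf w) vol β u = (1 / (k.factorial : ℝ)) *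
      ∑ c : Fin k → Fin 4, β (fun m => b (c m)) * vol (Fin.append (fun m => b (c m)) u) := by
  have : (fun v => vol (Fin.append v u)) = fixLast volM u := by
    ext v
    rw [fixLast_apply, hvol]
  rw [hodgeStar, this, hb.innerForm_eq]
  simp [fixLast_apply, hvol]

lemma exists_multilinear_volOf (w : Fin 3 → V4 [⋀^Fin 2]→L[ℝ] ℝ) :
    ∃ volM : MultilinearMap ℝ (fun _ : Fin (2 + 2) => V4) ℝ, ∀ v, volM v = volOf w v :=
  ⟨(1 / 2 : ℝ) • wedgeForm (w 0).toMultilinearMap (w 0).toMultilinearMap, fun v => by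
    rw [smul_apply, wedgeForm_apply]; rfl⟩

lemma sum_perm_succ {n : ℕ} (F : Equiv.Perm (Fin (n + 1)) → ℝ) : ∑ σ, F σ =
    ∑ p : Fin (n + 1), ∑ e : Equiv.Perm (Fin n), F (Equiv.Perm.decomposeFin.symm (p, e)) := by
  rw [← Fintype.sum_prod_type', ← Equiv.sum_comp Equiv.Perm.decomposeFin.symm]

/-- The sum is a multiple of the Pfaffian: each of the three pairings of four indices arises from 8
permutations. Hence `½ ω₁ ∧ ω₁` is the Pfaffian of `ω₁`, as `½ · 8 / (2! 2!) = 1`. -/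
lemma sum_perm_fin_four (A : Fin 4 → Fin 4 → ℝ) (hA : ∀ i j, A i j = -A j i) :
    ∑ σ : Equiv.Perm (Fin 4), ((Equiv.Perm.sign σ : ℤ) : ℝ) * A (σ 0) (σ 1) * A (σ 2) (σ 3)
      = 8 * (A 0 1 * A 2 3 - A 0 2 * A 1 3 + A 0 3 * A 1 2) := by
  have e3 : (3 : Fin 4) = Fin.succ 2 := rfl
  have e2 : (2 : Fin 4) = Fin.succ 1 := rfl
  have e1 : (1 : Fin 4) = Fin.succ 0 := rfl
  have f2 : (2 : Fin 3) = Fin.succ 1 := rfl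
  have f1 : (1 : Fin 3) = Fin.succ 0 := rfl
  rw [sum_perm_succ, Fin.sum_univ_four]
  simp only [sum_perm_succ, Fin.isValue, Fintype.sum_unique,
    Equiv.Perm.decomposeFin.symm_sign, e3, e2, e1, f2, f1,
    Equiv.Perm.decomposeFin_symm_apply_zero, Equiv.Perm.decomposeFin_symm_apply_succ]
  simp [Fin.sum_univ_three, Equiv.swap_apply_def]
  simp only [hA 1 0, hA 2 0, hA 3 0, hA 2 1, hA 3 1, hA 3 2]
  ring

lemma volOf_eq (w : Fin 3 → V4 [⋀^Fin 2]→L[ℝ] ℝ) (v : Fin (2 + 2) → V4) :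
    volOf w v = formBilin (w 0) (v 0) (v 1) * formBilin (w 0) (v 2) (v 3)
      - formBilin (w 0) (v 0) (v 2) * formBilin (w 0) (v 1) (v 3)
      + formBilin (w 0) (v 0) (v 3) * formBilin (w 0) (v 1) (v 2) := by
  have h : ∀ u : Fin 2 → V4, w 0 u = formBilin (w 0) (u 0) (u 1) := fun u => by
    rw [formBilin_apply]; congr 1; ext i; fin_cases i <;> rfl
  have := sum_perm_fin_four (fun i j => formBilin (w 0) (v i) (v j))
    fun i j => formBilin_antisymm _ _ _
  simp only [volOf, wedge, h]
  change (1 / 2 : ℝ) * (_ * ∑ σ : Equiv.Perm (Fin 4), ((Equiv.Perm.sign σ : ℤ) : ℝ) *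
    formBilin (w 0) (v (σ 0)) (v (σ 1)) * formBilin (w 0) (v (σ 2)) (v (σ 3))) = _
  rw [this]
  norm_num [Nat.factorial]
  ring

lemma AdaptedFrame.form_apply (hb : AdaptedFrame w b) (i : Fin 3) (u v : V4) :
    formBilin (w i) u v = ∑ p, ∑ q, b.repr u p * stdMat i p q * b.repr v q := by
  conv_lhs => rw [← b.sum_repr u, ← b.sum_repr v]
  simp only [map_sum, map_smul, sum_apply, smul_apply, smul_eq_mul, hb i _ _, Finset.mul_sum]
  rw [Finset.sum_comm]
  refine Finset.sum_congr rfl fun i _ => Finset.sum_congr rfl fun j _ => ?_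
  ring

lemma AdaptedFrame.form_basis_apply (hb : AdaptedFrame w b) (i : Fin 3) (p : Fin 4) (v : V4) :
    formBilin (w i) (b p) v = ∑ q, stdMat i p q * b.repr v q := by
  conv_lhs => rw [← b.sum_repr v]
  simp only [map_sum, map_smul, smul_eq_mul, hb i _ _, mul_comm]

/-! ### Inner product, diamond action and Hodge star on the model forms -/

lemma sum_fun_fin_two (F : (Fin 2 → Fin 4) → ℝ) : ∑ c, F c = ∑ p, ∑ q, F ![p, q] := by
  rw [← (finTwoArrowEquiv (Fin 4)).symm.sum_comp, Fintype.sum_prod_type]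
  rfl

lemma sum_fun_fin_three (F : (Fin 3 → Fin 4) → ℝ) :
    ∑ c, F c = ∑ p, ∑ q, ∑ r, F ![p, q, r] := by
  rw [← (Fin.consEquiv fun _ : Fin 3 => Fin 4).sum_comp, Fintype.sum_prod_type]
  refine Finset.sum_congr rfl fun p _ => ?_
  rw [sum_fun_fin_two]
  rfl

lemma form_pair (α : V4 [⋀^Fin 2]→L[ℝ] ℝ) (u : Fin 2 → V4) :
    α u = formBilin α (u 0) (u 1) := by
  rw [formBilin_apply]
  congr 1
  ext i
  fin_cases i <;> rfl

lemma formBilin_injective : Function.Injective formBilin := fun α β h => by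
  ext v
  rw [form_pair, h, ← form_pair]

/-- The model forms are mutually orthogonal with squared norm 2. -/
lemma AdaptedFrame.innerForm_sum (hb : AdaptedFrame w b) {N : (Fin 2 → V4) → ℝ} (c : Fin 3 → ℝ)
    (hN : ∀ v, N v = ∑ i, c i * formBilin (w i) (v 0) (v 1)) (j : Fin 3) :
    innerForm (metricOf w) N (w j) = 2 * c j := by
  have h : N = (∑ i, c i • (w i).toMultilinearMap : MultilinearMap ℝ (fun _ : Fin 2 => V4) ℝ) := by
    ext v
    simp [hN, ← form_pair]
  rw [h]
  have := hb.innerForm_eq (∑ i, c i • (w i).toMultilinearMap) (w j).toMultilinearMap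
  refine this.trans ?_
  have hw : ∀ u, (w j).toMultilinearMap u = formBilin (w j) (u 0) (u 1) := form_pair (w j)
  rw [← h, sum_fun_fin_two]
  simp only [hN, hw, Matrix.cons_val_zero,
    Matrix.cons_val_one, hb _ _ _]
  fin_cases j <;> simp [Fin.sum_univ_four, Fin.sum_univ_three, stdMat, Nat.factorial] <;> ring

lemma AdaptedFrame.diamond_eq (hb : AdaptedFrame w b) (A α : V4 [⋀^Fin 2]→L[ℝ] ℝ)
    (v : Fin 2 → V4) :
    diamond (metricOf w) A α v = (1 / 2) * ∑ c, (formBilin A (b c) (v 0) * formBilin α (b c) (v 1)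
      + formBilin A (b c) (v 1) * formBilin α (v 0) (b c)) := by
  have := hb.sum_gInv_mul (LinearMap.mk₂ ℝ (fun x y => formBilin A x (v 0) * formBilin α y (v 1)
      + formBilin A x (v 1) * formBilin α (v 0) y)
      (by intros; simp; ring) (by intros; simp; ring) (by intros; simp; ring)
      (by intros; simp; ring))
  simp only [LinearMap.mk₂_apply] at this
  rw [← this]
  simp [diamond, formBilin_apply]

lemma AdaptedFrame.metric_parseval (hb : AdaptedFrame w b) (u v : V4) :
    ∑ c, metricBilin w u (b c) * metricBilin w v (b c) = metricBilin w u v := by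
  conv_rhs => rw [← hb.metric_sum_smul v]
  simp [mul_comm]

/-- Writing each form as `g(J ·, ·)`, Parseval turns the contraction into the commutator of `J_i`
and `J_j`. -/
lemma AdaptedFrame.diamond_form (hb : AdaptedFrame w b) (i j : Fin 3) (v : Fin 2 → V4) :
    diamond (metricOf w) (w i) (w j) v = (1 / 2) * metricBilin w
      (cplx w i (cplx w j (v 0)) - cplx w j (cplx w i (v 0))) (v 1) := by
  have h : ∀ c, formBilin (w i) (b c) (v 0) * formBilin (w j) (b c) (v 1)
      + formBilin (w i) (b c) (v 1) * formBilin (w j) (v 0) (b c)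
      = metricBilin w (cplx w i (v 0)) (b c) * metricBilin w (cplx w j (v 1)) (b c)
      - metricBilin w (cplx w i (v 1)) (b c) * metricBilin w (cplx w j (v 0)) (b c) := by
    intro c
    simp only [hb.metric_cplx, formBilin_antisymm _ (b c)]
    ring
  rw [hb.diamond_eq, Finset.sum_congr rfl fun c _ => h c, Finset.sum_sub_distrib,
    hb.metric_parseval, hb.metric_parseval, hb.metric_symm (cplx w i (v 1)),
    hb.metric_cplx_right, hb.metric_cplx_right, map_sub, sub_apply, hb.metric_cplx,
    hb.metric_cplx]
  ring

lemma AdaptedFrame.diamond_sum (hb : AdaptedFrame w b) (c : Fin 3 → ℝ) (j : Fin 3)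
    (v : Fin 2 → V4) :
    diamond (metricOf w) (∑ i, c i • w i : V4 [⋀^Fin 2]→L[ℝ] ℝ) (w j) v =
      c (j + 2) * formBilin (w (j + 1)) (v 0) (v 1)
        - c (j + 1) * formBilin (w (j + 2)) (v 0) (v 1) := by
  have hlin : diamond (metricOf w) (∑ i, c i • w i : V4 [⋀^Fin 2]→L[ℝ] ℝ) (w j) v =
      ∑ i, c i * diamond (metricOf w) (w i) (w j) v := by
    simp only [hb.diamond_eq, Finset.mul_sum]
    rw [Finset.sum_comm]
    refine Finset.sum_congr rfl fun p _ => ?_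
    simp only [Fin.sum_univ_three, map_add, map_smul, add_apply, smul_apply, smul_eq_mul]
    ring
  have hs : ∀ F : Fin 3 → ℝ, ∑ i, F i = F j + F (j + 1) + F (j + 2) := by
    intro F
    rw [Fin.sum_univ_three]
    fin_cases j <;> simp <;> ring
  have e : j + 2 + 1 = j := by fin_cases j <;> rfl
  have e' : j + 2 + 2 = j + 1 := by fin_cases j <;> rfl
  have h1 := hb.cplx_cplx_next j (v 0)
  have h2 := hb.cplx_next_cplx j (v 0)
  have h3 := hb.cplx_cplx_next (j + 2) (v 0)
  have h4 := hb.cplx_next_cplx (j + 2) (v 0)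
  rw [e, e'] at h3 h4
  rw [hlin, hs]
  simp only [hb.diamond_form, h1, h2, h3, h4, sub_self, map_sub, map_neg, sub_apply, neg_apply,
    hb.metric_cplx, map_zero, zero_apply]
  ring

lemma AdaptedFrame.starTwo_eq (hb : AdaptedFrame w b) (β : V4 [⋀^Fin 2]→L[ℝ] ℝ)
    (v : Fin 2 → V4) :
    hodgeStar (k := 2) (l := 2) (metricOf w) (volOf w) β v =
      (1 / 2) * ∑ p, ∑ q, formBilin β (b p) (b q) *
        (stdMat 0 p q * formBilin (w 0) (v 0) (v 1)
          - formBilin (w 0) (b p) (v 0) * formBilin (w 0) (b q) (v 1)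
          + formBilin (w 0) (b p) (v 1) * formBilin (w 0) (b q) (v 0)) := by
  obtain ⟨volM, hvol⟩ := exists_multilinear_volOf w
  refine (hb.hodgeStar_eq volM hvol β.toMultilinearMap v).trans ?_
  have hβ : ∀ u, β.toMultilinearMap u = formBilin β (u 0) (u 1) := form_pair β
  rw [sum_fun_fin_two]
  simp only [hβ, volOf_eq, ← hb 0]
  rfl

lemma AdaptedFrame.starTwo_eq_self_iff (hb : AdaptedFrame w b) (β : V4 [⋀^Fin 2]→L[ℝ] ℝ) :
    (∀ v, hodgeStar (k := 2) (l := 2) (metricOf w) (volOf w) β v = β v) ↔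
      ∃ c : Fin 3 → ℝ, β = ∑ i, c i • w i := by
  constructor
  · intro h
    have hd : ∀ p, formBilin β (b p) (b p) = 0 := fun p => by
      have := formBilin_antisymm β (b p) (b p)
      linarith
    have h' : ∀ p q, formBilin β (b p) (b q) = _ := fun p q =>
      (formBilin_apply β _ _).trans ((h ![b p, b q]).symm.trans (hb.starTwo_eq β _))
    have h1 := h' 0 1
    have h2 := h' 0 2
    have h3 := h' 0 3
    simp only [Matrix.cons_val_zero, Matrix.cons_val_one, hb 0 _ _] at h1 h2 h3
    simp [Fin.sum_univ_four, stdMat, hd, formBilin_antisymm β (b 2) (b 1), formBilin_antisymm β (b 3) (b 1),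
      formBilin_antisymm β (b 3) (b 2)] at h1 h2 h3
    -- Each pair `(b 0, b q)` with `q ≠ 0` is seen by exactly one model form, with value 1, so the
    -- first row gives the coefficients; self-duality determines the other entries.
    refine ⟨![formBilin β (b 0) (b 1), formBilin β (b 0) (b 2), formBilin β (b 0) (b 3)], ?_⟩
    have : formBilin β = formBilin (∑ i, ![formBilin β (b 0) (b 1), formBilin β (b 0) (b 2),
        formBilin β (b 0) (b 3)] i • w i) := by
      refine bilin_ext_basis b fun p q => ?_
      simp only [map_sum, map_smul, sum_apply, smul_apply, smul_eq_mul, hb _ _ _]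
      fin_cases p <;> fin_cases q <;> simp [Fin.sum_univ_three, stdMat, hd,
        formBilin_antisymm β (b 1) (b 0),
        formBilin_antisymm β (b 2) (b 0), formBilin_antisymm β (b 3) (b 0),
        formBilin_antisymm β (b 2) (b 1), formBilin_antisymm β (b 3) (b 1),
        formBilin_antisymm β (b 3) (b 2)] <;> linarith
    exact formBilin_injective this
  · rintro ⟨c, rfl⟩ v
    rw [hb.starTwo_eq, form_pair]
    simp only [map_sum, map_smul, sum_apply, smul_apply, smul_eq_mul, hb _ _ _,
      hb.form_basis_apply, hb.form_apply]
    simp only [Fin.sum_univ_three, Fin.sum_univ_four]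
    simp [stdMat]
    ring

/-- Component form of `*(α ∧ ω_j) = -J_j α`; the factor 6 cancels the `1/3!` of the inner product on
`3`-forms. -/
lemma sum_wedge_stdMat (j : Fin 3) (α x : Fin 4 → ℝ) :
    ∑ p, ∑ q, ∑ r, (α p * stdMat j q r + α q * stdMat j r p + α r * stdMat j p q) *
      (stdMat 0 p q * (∑ s, stdMat 0 r s * x s) - stdMat 0 p r * (∑ s, stdMat 0 q s * x s)
        + (∑ s, stdMat 0 p s * x s) * stdMat 0 q r) = -6 * ∑ p, ∑ q, x p * stdMat j p q * α q := by
  fin_cases j <;> simp [Fin.sum_univ_four, stdMat] <;> ring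

/-- The Hodge star of a sum of wedge products `α_j ∧ ω_j`. -/
lemma AdaptedFrame.starThree_eq (hb : AdaptedFrame w b) (β : V4 [⋀^Fin 3]→L[ℝ] ℝ)
    (α : Fin 3 → V4 →ₗ[ℝ] ℝ)
    (hβ : ∀ x y z, β ![x, y, z] = ∑ j, (α j x * formBilin (w j) y z
      + α j y * formBilin (w j) z x + α j z * formBilin (w j) x y)) (u : V4) :
    hodgeStar (k := 3) (l := 1) (metricOf w) (volOf w) β ![u] = -∑ j, α j (cplx w j u) := by
  obtain ⟨volM, hvol⟩ := exists_multilinear_volOf w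
  refine (hb.hodgeStar_eq (k := 3) (l := 1) volM hvol β.toMultilinearMap ![u]).trans ?_
  have hβ' : ∀ p q r, β.toMultilinearMap (fun m => b (![p, q, r] m)) =
      ∑ j, (α j (b p) * stdMat j q r + α j (b q) * stdMat j r p + α j (b r) * stdMat j p q) := by
    intro p q r
    have : (fun m => b (![p, q, r] m)) = ![b p, b q, b r] := by
      ext m; fin_cases m <;> rfl
    rw [this]
    refine (hβ _ _ _).trans ?_
    simp only [hb _ _ _]
  have hv : ∀ p q r, volOf w (Fin.append (fun m => b (![p, q, r] m)) ![u] : Fin (3 + 1) → V4) =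
      stdMat 0 p q * (∑ s, stdMat 0 r s * b.repr u s)
        - stdMat 0 p r * (∑ s, stdMat 0 q s * b.repr u s)
        + (∑ s, stdMat 0 p s * b.repr u s) * stdMat 0 q r := by
    intro p q r
    rw [volOf_eq, ← hb.form_basis_apply, ← hb.form_basis_apply, ← hb.form_basis_apply, ← hb 0,
      ← hb 0, ← hb 0]
    rfl
  have hα : ∀ j, α j (cplx w j u) = ∑ p, ∑ q, b.repr u p * stdMat j p q * α j (b q) := by
    intro j
    conv_lhs => rw [← b.sum_repr u]
    simp [-Module.Basis.sum_repr, hb.cplx_basis, Finset.mul_sum, mul_assoc]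
  rw [sum_fun_fin_three]
  have hsum : ∀ (A : Fin 3 → Fin 4 → Fin 4 → Fin 4 → ℝ) (P : Fin 4 → Fin 4 → Fin 4 → ℝ),
      ∑ p, ∑ q, ∑ r, (∑ j, A j p q r) * P p q r = ∑ j, ∑ p, ∑ q, ∑ r, A j p q r * P p q r := by
    intro A P
    simp only [Fin.sum_univ_three, add_mul, Finset.sum_add_distrib]
  simp only [hβ', hv, hsum, hα]
  simp only [sum_wedge_stdMat _ (fun p => α _ (b p)) (b.repr u)]
  rw [← Finset.mul_sum]
  norm_num [Nat.factorial]
  ring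

/-! ### Covariant derivatives of the forms in a chart -/

section Local

variable {W : V4 → Fin 3 → V4 [⋀^Fin 2]→L[ℝ] ℝ} {y₀ : V4}

lemma hasFDerivAt_formBilin {η : V4 → V4 [⋀^Fin 2]→L[ℝ] ℝ} (hη : DifferentiableAt ℝ η y₀) :
    HasFDerivAt (fun y => formBilin (η y)) (formBilin.comp (fderiv ℝ η y₀)) y₀ := by
  refine HasFDerivAt.comp (g := fun α => formBilin α) (g' := formBilin) y₀ ?_ hη.hasFDerivAt
  apply ContinuousLinearMap.hasFDerivAt

lemma differentiableAt_curryLeft {η : V4 → V4 [⋀^Fin 2]→L[ℝ] ℝ} (hη : DifferentiableAt ℝ η y₀) :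
    DifferentiableAt ℝ (fun y => (η y).curryLeft) y₀ := by
  refine DifferentiableAt.comp (g := fun α : V4 [⋀^Fin 2]→L[ℝ] ℝ => α.curryLeft) y₀ ?_ hη
  apply (ContinuousAlternatingMap.curryLeftLI (𝕜 := ℝ) (E := V4) (F := ℝ)
      (n := 1)).toContinuousLinearMap.differentiableAt

/-- Inversion of linear maps is smooth at an invertible one, so an adapted frame at the single point
`y₀` suffices. -/
lemma differentiableAt_cplx (hW : ∀ i, DifferentiableAt ℝ (fun y => W y i) y₀)
    {b : Module.Basis (Fin 4) ℝ V4} (hb : AdaptedFrame (W y₀) b) (i : Fin 3) :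
    DifferentiableAt ℝ (fun y => cplx (W y) i) y₀ := by
  have hc : ∀ j, DifferentiableAt ℝ (fun y => (W y j).curryLeft) y₀ := fun j =>
    differentiableAt_curryLeft (hW j)
  obtain ⟨e, he⟩ := hb.isInvertible_curryLeft (i + 1)
  have hinv : DifferentiableAt ℝ (fun y => (W y (i + 1)).curryLeft.inverse) y₀ := by
    have h := (contDiffAt_map_inverse (𝕜 := ℝ) (n := 1) e).differentiableAt (by simp)
    rw [he] at h
    refine DifferentiableAt.comp (𝕜 := ℝ)
      (g := fun f : V4 →L[ℝ] V4 [⋀^Fin 1]→L[ℝ] ℝ => f.inverse) y₀ ?_ ?_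
    · exact h
    · exact hc (i + 1)
  exact (hinv.clm_comp (hc (i + 2))).neg

lemma differentiableAt_formBilin (hW : ∀ i, DifferentiableAt ℝ (fun y => W y i) y₀) (i : Fin 3) :
    DifferentiableAt ℝ (fun y => formBilin (W y i)) y₀ :=
  (hasFDerivAt_formBilin (hW i)).differentiableAt

lemma differentiableAt_metricBilin (hW : ∀ i, DifferentiableAt ℝ (fun y => W y i) y₀)
    {b : Module.Basis (Fin 4) ℝ V4} (hb : AdaptedFrame (W y₀) b) :
    DifferentiableAt ℝ (fun y => metricBilin (W y)) y₀ :=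
  ((differentiableAt_formBilin hW 0).clm_comp (differentiableAt_cplx hW hb 0)).neg

lemma fderiv_bilin_apply {B : V4 → V4 →L[ℝ] V4 →L[ℝ] ℝ} (hB : DifferentiableAt ℝ B y₀)
    (X u v : V4) : fderiv ℝ (fun y => B y u v) y₀ X = fderiv ℝ B y₀ X u v := by
  have h1 : HasFDerivAt (fun y => B y u) ((fderiv ℝ B y₀).flip u) y₀ :=
    hB.hasFDerivAt.clm_apply (hasFDerivAt_const u y₀) |>.congr_fderiv (by ext; simp)
  have h2 : HasFDerivAt (fun y => B y u v) (((fderiv ℝ B y₀).flip u).flip v) y₀ :=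
    h1.clm_apply (hasFDerivAt_const v y₀) |>.congr_fderiv (by ext; simp)
  rw [h2.fderiv]
  rfl

lemma hasFDerivAt_bilin_comp_apply {B : V4 → V4 →L[ℝ] V4 →L[ℝ] ℝ} {J : V4 → V4 →L[ℝ] V4}
    (hB : DifferentiableAt ℝ B y₀) (hJ : DifferentiableAt ℝ J y₀) (u v : V4) :
    ∃ L : V4 →L[ℝ] ℝ, HasFDerivAt (fun y => B y (J y u) v) L y₀ ∧
      ∀ X, L X = fderiv ℝ B y₀ X (J y₀ u) v + B y₀ (fderiv ℝ J y₀ X u) v := by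
  have h1 : HasFDerivAt (fun y => J y u) ((fderiv ℝ J y₀).flip u) y₀ :=
    hJ.hasFDerivAt.clm_apply (hasFDerivAt_const u y₀) |>.congr_fderiv (by ext; simp)
  refine ⟨_, (hB.hasFDerivAt.clm_apply h1).clm_apply (hasFDerivAt_const v y₀), fun X => ?_⟩
  simp [add_comm]

/-- The Christoffel symbols of the metric of a triple define a symmetric metric connection. -/
lemma exists_leviCivita (hW : ∀ i, DifferentiableAt ℝ (fun y => W y i) y₀)
    (hA : ∀ᶠ y in 𝓝 y₀, ∃ b, AdaptedFrame (W y) b) {g : V4 → V4 → V4 → ℝ}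
    (hg : ∀ᶠ y in 𝓝 y₀, g y = metricOf (W y)) :
    ∃ Γ : V4 →ₗ[ℝ] V4 →ₗ[ℝ] V4, (∀ v u, christoffel g y₀ v u = Γ v u) ∧
      (∀ v u, Γ v u = Γ u v) ∧
      ∀ X u v, fderiv ℝ (fun y => metricBilin (W y)) y₀ X u v =
        metricBilin (W y₀) (Γ X u) v + metricBilin (W y₀) u (Γ X v) := by
  obtain ⟨b, hb⟩ := hA.self_of_nhds
  have hG := differentiableAt_metricBilin hW hb
  set D := fderiv ℝ (fun y => metricBilin (W y)) y₀ with hD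
  have hDsymm : ∀ X u v, D X u v = D X v u := by
    intro X u v
    rw [hD, ← fderiv_bilin_apply hG, ← fderiv_bilin_apply hG]
    congr 1
    apply EventuallyEq.fderiv_eq
    filter_upwards [hA] with y ⟨b, hb⟩ using hb.metric_symm u v
  have hfd : ∀ X u v, fderiv ℝ (fun z => g z u v) y₀ X = D X u v := by
    intro X u v
    rw [hD, ← fderiv_bilin_apply hG]
    congr 1
    apply EventuallyEq.fderiv_eq
    filter_upwards [hg] with y hy
    rw [hy, metricBilin_apply]
  have hext : ∀ a c, (∀ z, metricBilin (W y₀) a z = metricBilin (W y₀) c z) → a = c := by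
    intro a c h
    rw [← hb.metric_sum_smul a, ← hb.metric_sum_smul c]
    simp only [h]
  -- Koszul's formula. By nondegeneracy (`hext`), bilinearity and symmetry of `Γ` can be checked
  -- after pairing with `z`.
  have hchr : ∀ v u z, metricBilin (W y₀) (christoffel g y₀ v u) z =
      (1 / 2) * (D v u z + D u v z - D z v u) := by
    intro v u z
    have h := hb.sum_gInv_mul (LinearMap.mk₂ ℝ (fun x y => metricBilin (W y₀) x z *
      ((1 / 2) * (D v u y + D u v y - D y v u)))
      (by intros; simp; ring) (by intros; simp; ring) (by intros; simp; ring)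
      (by intros; simp; ring))
    simp only [LinearMap.mk₂_apply] at h
    have hz : z = ∑ p, metricBilin (W y₀) (b p) z • b p := by
      conv_lhs => rw [← hb.metric_sum_smul z]
      simp only [hb.metric_symm z]
    have h2 : (1 / 2) * (D v u z + D u v z - D z v u) =
        ∑ c, metricBilin (W y₀) (b c) z * ((1 / 2) * (D v u (b c) + D u v (b c) - D (b c) v u)) := by
      conv_lhs => rw [hz]
      simp only [map_sum, map_smul, sum_apply, smul_apply, smul_eq_mul, Finset.mul_sum,
        ← Finset.sum_add_distrib, ← Finset.sum_sub_distrib]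
      refine Finset.sum_congr rfl fun c _ => ?_
      ring
    rw [h2, ← h, christoffel]
    simp only [hfd, hg.self_of_nhds, map_sum, map_smul, sum_apply, smul_apply, smul_eq_mul]
    refine Finset.sum_congr rfl fun i _ => Finset.sum_congr rfl fun j _ => ?_
    ring
  refine ⟨LinearMap.mk₂ ℝ (christoffel g y₀) ?_ ?_ ?_ ?_, fun _ _ => rfl, ?_, ?_⟩
  · intro v v' u
    apply hext
    intro z
    simp only [map_add, add_apply, hchr]
    ring
  · intro r v u
    apply hext
    intro z
    simp only [map_smul, smul_apply, hchr, smul_eq_mul]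
    ring
  · intro v u u'
    apply hext
    intro z
    simp only [map_add, add_apply, hchr]
    ring
  · intro r v u
    apply hext
    intro z
    simp only [map_smul, smul_apply, hchr, smul_eq_mul]
    ring
  · intro v u
    apply hext
    intro z
    simp only [LinearMap.mk₂_apply, hchr, hDsymm z v u]
    ring
  · intro X u v
    simp only [LinearMap.mk₂_apply]
    rw [hb.metric_symm u, hchr, hchr, hDsymm X v u, hDsymm v X u, hDsymm u X v]
    ring

/-- The covariant derivative of the form `W i` with respect to the connection `Γ`. -/
def covD (W : V4 → Fin 3 → V4 [⋀^Fin 2]→L[ℝ] ℝ) (y₀ : V4) (Γ : V4 →ₗ[ℝ] V4 →ₗ[ℝ] V4) (i : Fin 3)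
    (X u v : V4) : ℝ :=
  formBilin (fderiv ℝ (fun y => W y i) y₀ X) u v - formBilin (W y₀ i) (Γ X u) v
    - formBilin (W y₀ i) u (Γ X v)

lemma covD_antisymm (Γ : V4 →ₗ[ℝ] V4 →ₗ[ℝ] V4) (i : Fin 3) (X u v : V4) :
    covD W y₀ Γ i X u v = -covD W y₀ Γ i X v u := by
  simp only [covD]
  rw [formBilin_antisymm _ u, formBilin_antisymm _ (Γ X u), formBilin_antisymm _ u]
  ring

/-- The covariant derivative of `ω_i(J_j u, v) + ω_j(J_i u, v) = -2 δ_ij g(u, v)`. As `J_i` is skew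
and `∇g = 0`, `ω_i((∇J_j) u, v) = -(∇ω_j)(u, J_i v)`, which eliminates the derivatives of the `J`.
-/
lemma covD_clifford (hW : ∀ i, DifferentiableAt ℝ (fun y => W y i) y₀)
    (hA : ∀ᶠ y in 𝓝 y₀, ∃ b, AdaptedFrame (W y) b) {Γ : V4 →ₗ[ℝ] V4 →ₗ[ℝ] V4}
    (hΓ : ∀ X u v, fderiv ℝ (fun y => metricBilin (W y)) y₀ X u v =
        metricBilin (W y₀) (Γ X u) v + metricBilin (W y₀) u (Γ X v))
    (i j : Fin 3) (X u v : V4) :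
    covD W y₀ Γ i X (cplx (W y₀) j u) v - covD W y₀ Γ j X u (cplx (W y₀) i v)
      + covD W y₀ Γ j X (cplx (W y₀) i u) v - covD W y₀ Γ i X u (cplx (W y₀) j v) = 0 := by
  obtain ⟨b, hb⟩ := hA.self_of_nhds
  have hG := differentiableAt_metricBilin hW hb
  have hJ := differentiableAt_cplx hW hb
  have hF := differentiableAt_formBilin hW
  have hfF : ∀ i, fderiv ℝ (fun y => formBilin (W y i)) y₀ X =
      formBilin (fderiv ℝ (fun y => W y i) y₀ X) := fun i => by
    rw [(hasFDerivAt_formBilin (hW i)).fderiv]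
    rfl
  have h1 : ∀ i u v, formBilin (fderiv ℝ (fun y => W y i) y₀ X) u v =
      fderiv ℝ (fun y => metricBilin (W y)) y₀ X (cplx (W y₀) i u) v
        + metricBilin (W y₀) (fderiv ℝ (fun y => cplx (W y) i) y₀ X u) v := by
    intro i u v
    obtain ⟨L, hL, hL'⟩ := hasFDerivAt_bilin_comp_apply hG (hJ i) u v
    rw [← hL', ← hL.fderiv, ← hfF, ← fderiv_bilin_apply (hF i)]
    congr 1
    apply EventuallyEq.fderiv_eq
    filter_upwards [hA] with y ⟨b, hb⟩ using (hb.metric_cplx i u v).symm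
  have hcl : ∀ᶠ y in 𝓝 y₀, formBilin (W y i) (cplx (W y) j u) v
      + formBilin (W y j) (cplx (W y) i u) v
      = (if i = j then -2 else 0 : ℝ) * metricBilin (W y) u v := by
    filter_upwards [hA] with y ⟨b, hb⟩
    rw [← hb.metric_cplx, ← hb.metric_cplx, ← add_apply, ← map_add, hb.cplx_anticomm, map_smul,
      smul_apply, smul_eq_mul]
  have h2 : formBilin (fderiv ℝ (fun y => W y i) y₀ X) (cplx (W y₀) j u) v
      + formBilin (W y₀ i) (fderiv ℝ (fun y => cplx (W y) j) y₀ X u) v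
      + (formBilin (fderiv ℝ (fun y => W y j) y₀ X) (cplx (W y₀) i u) v
      + formBilin (W y₀ j) (fderiv ℝ (fun y => cplx (W y) i) y₀ X u) v) =
      (if i = j then -2 else 0 : ℝ) * fderiv ℝ (fun y => metricBilin (W y)) y₀ X u v := by
    obtain ⟨L, hL, hL'⟩ := hasFDerivAt_bilin_comp_apply (hF i) (hJ j) u v
    obtain ⟨L', hM, hM'⟩ := hasFDerivAt_bilin_comp_apply (hF j) (hJ i) u v
    have hGd : DifferentiableAt ℝ (fun y => metricBilin (W y) u v) y₀ :=
      (hG.clm_apply (differentiableAt_const u)).clm_apply (differentiableAt_const v)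
    rw [← hfF, ← hfF, ← hL', ← hM', ← fderiv_bilin_apply hG, ← add_apply, ← (hL.add hM).fderiv]
    have := EventuallyEq.fderiv_eq (𝕜 := ℝ) hcl
    rw [fderiv_const_mul hGd] at this
    exact congrArg (fun f => f X) this
  -- The derivative of `J_j` is traded for that of `ω_j` by moving `J_i` to the other argument.
  have h3 : ∀ i j, formBilin (W y₀ i) (fderiv ℝ (fun y => cplx (W y) j) y₀ X u) v =
      -formBilin (fderiv ℝ (fun y => W y j) y₀ X) u (cplx (W y₀) i v)
        + fderiv ℝ (fun y => metricBilin (W y)) y₀ X (cplx (W y₀) j u) (cplx (W y₀) i v) := by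
    intro i j
    rw [h1, hb.metric_cplx_right]
    ring
  have hcl0 : ∀ u v, formBilin (W y₀ i) (cplx (W y₀) j u) v
      + formBilin (W y₀ j) (cplx (W y₀) i u) v
      = (if i = j then -2 else 0 : ℝ) * metricBilin (W y₀) u v := by
    intro u v
    rw [← hb.metric_cplx, ← hb.metric_cplx, ← add_apply, ← map_add, hb.cplx_anticomm, map_smul,
      smul_apply, smul_eq_mul]
  have e1 := hcl0 u (Γ X v)
  have e2 := hcl0 (Γ X u) v
  have e3 : ∀ i j, formBilin (W y₀ i) (Γ X u) (cplx (W y₀) j v) =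
      -formBilin (W y₀ j) (cplx (W y₀) i (Γ X u)) v := by
    intro i j
    rw [← hb.metric_cplx i, hb.metric_cplx_right]
  rw [h3, h3] at h2
  simp only [hΓ, hb.metric_cplx, hb.metric_cplx_right] at h2
  simp only [covD, e3]
  linarith

/-- The relations with `i = j` leave only the components of `n i` along the other two model forms;
those with `i ≠ j`, needed only at `p = q = 0`, make the remaining coefficients skew. The three
listed entries are positions where only the wanted coefficient survives. -/
lemma clifford_solution (n : Fin 3 → Fin 4 → Fin 4 → ℝ) (hn : ∀ i p q, n i p q = -n i q p)
    (h : ∀ i j p q, ∑ r, stdMat j p r * n i r q - ∑ r, stdMat i q r * n j p r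
      + ∑ r, stdMat i p r * n j r q - ∑ r, stdMat j q r * n i p r = 0) (i : Fin 3) (p q : Fin 4) :
    n i p q = ![n 1 0 3, n 2 0 1, n 0 0 2] (i + 2) * stdMat (i + 1) p q
      - ![n 1 0 3, n 2 0 1, n 0 0 2] (i + 1) * stdMat (i + 2) p q := by
  have hd : ∀ i p, n i p p = 0 := fun i p => by linarith [hn i p p]
  have h01 := h 0 1 0 0
  have h12 := h 1 2 0 0
  have h20 := h 2 0 0 0
  have hs := fun p q => h i i p q
  have a1 := fun i => hn i 1 0
  have a2 := fun i => hn i 2 0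
  have a3 := fun i => hn i 3 0
  have a4 := fun i => hn i 2 1
  have a5 := fun i => hn i 3 1
  have a6 := fun i => hn i 3 2
  have hs00 := hs 0 0
  have hs01 := hs 0 1
  have hs02 := hs 0 2
  have hs03 := hs 0 3
  have hs12 := hs 1 2
  have hs13 := hs 1 3
  have hs23 := hs 2 3
  have hs11 := hs 1 1
  have hs22 := hs 2 2
  fin_cases i <;> simp [Fin.sum_univ_four, stdMat, hd, a1, a2, a3, a4, a5, a6]
      at h01 h12 h20 hs00 hs01 hs02 hs03 hs12 hs13 hs23 hs11 hs22 <;>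
    fin_cases p <;> fin_cases q <;> simp [stdMat, hd, a1, a2, a3, a4, a5, a6] <;> linarith

/-- The covariant derivative of `W i` along `X` as a bilinear map. -/
def covDBilin (W : V4 → Fin 3 → V4 [⋀^Fin 2]→L[ℝ] ℝ) (y₀ : V4) (Γ : V4 →ₗ[ℝ] V4 →ₗ[ℝ] V4)
    (i : Fin 3) (X : V4) : V4 →L[ℝ] V4 →L[ℝ] ℝ :=
  formBilin (fderiv ℝ (fun y => W y i) y₀ X)
    - (formBilin (W y₀ i)).comp (LinearMap.toContinuousLinearMap (Γ X))
    - ((formBilin (W y₀ i)).flip.comp (LinearMap.toContinuousLinearMap (Γ X))).flip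

lemma covDBilin_apply (Γ : V4 →ₗ[ℝ] V4 →ₗ[ℝ] V4) (i : Fin 3) (X u v : V4) :
    covDBilin W y₀ Γ i X u v = covD W y₀ Γ i X u v := rfl

lemma exists_torsion_forms (hW : ∀ i, DifferentiableAt ℝ (fun y => W y i) y₀)
    (hA : ∀ᶠ y in 𝓝 y₀, ∃ b, AdaptedFrame (W y) b) {Γ : V4 →ₗ[ℝ] V4 →ₗ[ℝ] V4}
    (hΓ : ∀ X u v, fderiv ℝ (fun y => metricBilin (W y)) y₀ X u v =
        metricBilin (W y₀) (Γ X u) v + metricBilin (W y₀) u (Γ X v)) :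
    ∃ c : Fin 3 → V4 →ₗ[ℝ] ℝ, ∀ i X u v, covD W y₀ Γ i X u v =
      c (i + 2) X * formBilin (W y₀ (i + 1)) u v - c (i + 1) X * formBilin (W y₀ (i + 2)) u v := by
  obtain ⟨b, hb⟩ := hA.self_of_nhds
  let ev : Fin 3 → Fin 4 → Fin 4 → V4 →ₗ[ℝ] ℝ := fun i p q =>
    { toFun := fun X => covD W y₀ Γ i X (b p) (b q)
      map_add' := fun X Y => by simp only [covD, map_add, add_apply, LinearMap.add_apply]; ring
      map_smul' := fun r X => by
        simp only [covD, map_smul, smul_apply, LinearMap.smul_apply, smul_eq_mul,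
          RingHom.id_apply]
        ring }
  refine ⟨![ev 1 0 3, ev 2 0 1, ev 0 0 2], fun i X u v => ?_⟩
  have hc : ∀ k, (![ev 1 0 3, ev 2 0 1, ev 0 0 2] : Fin 3 → V4 →ₗ[ℝ] ℝ) k X =
      ![covD W y₀ Γ 1 X (b 0) (b 3), covD W y₀ Γ 2 X (b 0) (b 1), covD W y₀ Γ 0 X (b 0) (b 2)] k := by
    intro k
    fin_cases k <;> rfl
  rw [hc, hc]
  have hrel : ∀ i j p q, _ := fun i j p q => covD_clifford hW hA hΓ i j X (b p) (b q)
  simp only [← covDBilin_apply, hb.cplx_basis, map_sum, map_smul, sum_apply, smul_apply,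
    smul_eq_mul] at hrel
  have hsol := clifford_solution (fun i p q => covDBilin W y₀ Γ i X (b p) (b q))
    (fun i p q => covD_antisymm Γ i X (b p) (b q)) hrel i
  have : covDBilin W y₀ Γ i X =
      (![covD W y₀ Γ 1 X (b 0) (b 3), covD W y₀ Γ 2 X (b 0) (b 1),
        covD W y₀ Γ 0 X (b 0) (b 2)] (i + 2)) • formBilin (W y₀ (i + 1)) -
      (![covD W y₀ Γ 1 X (b 0) (b 3), covD W y₀ Γ 2 X (b 0) (b 1),
        covD W y₀ Γ 0 X (b 0) (b 2)] (i + 1)) • formBilin (W y₀ (i + 2)) := by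
    refine bilin_ext_basis b fun p q => ?_
    rw [sub_apply, sub_apply, smul_apply, smul_apply, smul_apply, smul_apply, hb, hb]
    exact hsol p q
  rw [← covDBilin_apply, this]
  rfl

/-- In the cyclic sum the connection terms cancel in pairs because `Γ` is symmetric. -/
lemma extDeriv_eq_sum_covD {Γ : V4 →ₗ[ℝ] V4 →ₗ[ℝ] V4} (hΓ : ∀ u v, Γ u v = Γ v u) (i : Fin 3)
    (x y z : V4) :
    extDeriv (fun y => W y i) y₀ ![x, y, z] =
      covD W y₀ Γ i x y z + covD W y₀ Γ i y z x + covD W y₀ Γ i z x y := by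
  have : extDeriv (fun y => W y i) y₀ ![x, y, z] =
      formBilin (fderiv ℝ (fun y => W y i) y₀ x) y z
        - formBilin (fderiv ℝ (fun y => W y i) y₀ y) x z
        + formBilin (fderiv ℝ (fun y => W y i) y₀ z) x y := by
    rw [extDeriv, ContinuousAlternatingMap.alternatizeUncurryFin_apply, Fin.sum_univ_three]
    simp only [form_pair]
    simp [Fin.removeNth, Fin.succAbove]
    ring
  rw [this]
  simp only [covD, hΓ y x, hΓ z x, hΓ z y, formBilin_antisymm (W y₀ i) (Γ _ _)]
  rw [formBilin_antisymm _ x z]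
  ring

lemma AdaptedFrame.pullback {w w' : Fin 3 → V4 [⋀^Fin 2]→L[ℝ] ℝ}
    {b : Module.Basis (Fin 4) ℝ V4} (hb : AdaptedFrame w b) (L : V4 ≃ₗ[ℝ] V4)
    (hw : ∀ i u v, w' i ![u, v] = w i ![L u, L v]) :
    AdaptedFrame w' (b.map L.symm) ∧ ∀ u v, metricOf w' u v = metricOf w (L u) (L v) := by
  have h : AdaptedFrame w' (b.map L.symm) := fun i p q => by
    rw [formBilin_apply, hw, ← formBilin_apply]
    simp [hb i p q]
  refine ⟨h, fun u v => ?_⟩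
  rw [← metricBilin_apply, ← metricBilin_apply, h.metric_apply, hb.metric_apply]
  simp

end Local

/-! ### From the chart to the manifold -/

namespace SU2Structure

variable {M : Type*} [TopologicalSpace M] [ChartedSpace V4 M] (S : SU2Structure M)

/-- The triple of forms in the chart at `x`. -/
def chartForms (x : M) (y : V4) : Fin 3 → V4 [⋀^Fin 2]→L[ℝ] ℝ := fun i => inChart (S.form i) x y

/-- The covariant derivative of `ω_i` at `x`, on the model tangent space. -/
def nablaForm (i : Fin 3) (x : M) (X : V4) (v : Fin 2 → V4) : ℝ := S.nabla (S.form i) x X v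

/-- The exterior derivative of `ω_i` at `x`, on the model tangent space. -/
def dForm (i : Fin 3) (x : M) : V4 [⋀^Fin 3]→L[ℝ] ℝ := extD (S.form i) x

lemma exists_adaptedFrame_at (x : M) : ∃ b, AdaptedFrame (S.at' x) b :=
  exists_adaptedFrame (S.adapted x)

lemma differentiableAt_chartForms (x : M) (i : Fin 3) :
    DifferentiableAt ℝ (fun y => S.chartForms x y i) (extChartAt (𝓡 4) x x) :=
  ((S.smooth i x).contDiffAt (extChartAt_target_mem_nhds x)).differentiableAt (by simp)

lemma starD_eq {x : M} {c : Fin 3 → V4 →ₗ[ℝ] ℝ}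
    (hc : ∀ i (X : V4) (v : Fin 2 → V4), S.nablaForm i x X v =
      c (i + 2) X * formBilin (S.at' x (i + 1)) (v 0) (v 1)
        - c (i + 1) X * formBilin (S.at' x (i + 2)) (v 0) (v 1))
    (hd : ∀ i (X Y Z : V4), S.dForm i x ![X, Y, Z] =
      S.nablaForm i x X ![Y, Z] + S.nablaForm i x Y ![Z, X]
        + S.nablaForm i x Z ![X, Y]) (i : Fin 3) (X : V4) :
    S.starD i x X = c (i + 1) (cplx (S.at' x) (i + 2) X) - c (i + 2) (cplx (S.at' x) (i + 1) X) := by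
  obtain ⟨b, hb⟩ := S.exists_adaptedFrame_at x
  have h := hb.starThree_eq (S.dForm i x)
    -- The cyclic sum of `∇ω_i` is `c_{i+2} ∧ ω_{i+1} - c_{i+1} ∧ ω_{i+2}`.
    (fun j => if j = i + 1 then c (i + 2) else if j = i + 2 then -c (i + 1) else 0) (by
      intro X Y Z
      rw [hd, hc, hc, hc]
      fin_cases i <;> simp [Fin.sum_univ_three] <;> ring) X
  refine h.trans ?_
  fin_cases i <;> simp [Fin.sum_univ_three] <;> ring

variable [IsManifold (𝓡 4) ∞ M]

/-- The tangent space at `x` is modelled on `V4` through the preferred chart at `x`, so that chart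
has identity derivative there. Objects at `x` and their chart expressions at the base point then
coincide. -/
lemma mfderiv_extChartAt (x : M) :
    (mfderiv (𝓡 4) (𝓡 4) (extChartAt (𝓡 4) x) x : V4 →L[ℝ] V4) = ContinuousLinearMap.id ℝ V4 := by
  have : IsManifold (𝓡 4) 1 M := IsManifold.of_le (n := ∞) (by simp)
  exact mfderiv_extChartAt_self

lemma mfderiv_extChartAt_symm (x : M) :
    (mfderiv (𝓡 4) (𝓡 4) (extChartAt (𝓡 4) x).symm (extChartAt (𝓡 4) x x) : V4 →L[ℝ] V4) =
      ContinuousLinearMap.id ℝ V4 := by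
  have : IsManifold (𝓡 4) 1 M := IsManifold.of_le (n := ∞) (by simp)
  have h := mfderivWithin_range_extChartAt_symm (I := 𝓡 4) (x := x)
  rw [ModelWithCorners.range_eq_univ, mfderivWithin_univ] at h
  exact h

lemma exists_equiv_mfderiv_symm (x : M) {y : V4} (hy : y ∈ (extChartAt (𝓡 4) x).target) :
    ∃ L : V4 ≃ₗ[ℝ] V4, ∀ u : V4,
      (mfderiv (𝓡 4) (𝓡 4) (extChartAt (𝓡 4) x).symm y : V4 →L[ℝ] V4) u = L u := by
  have : IsManifold (𝓡 4) 1 M := IsManifold.of_le (n := ∞) (by simp)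
  have h := isInvertible_mfderivWithin_extChartAt_symm (I := 𝓡 4) hy
  rw [ModelWithCorners.range_eq_univ, mfderivWithin_univ] at h
  obtain ⟨e, he⟩ := h
  exact ⟨e.toLinearEquiv, fun u => by rw [← he]; rfl⟩

lemma chartForms_adapted (x : M) {y : V4} (hy : y ∈ (extChartAt (𝓡 4) x).target) :
    (∃ b, AdaptedFrame (S.chartForms x y) b) ∧ S.metricInChart x y = metricOf (S.chartForms x y) := by
  obtain ⟨b, hb⟩ := S.exists_adaptedFrame_at ((extChartAt (𝓡 4) x).symm y)
  obtain ⟨L, hL⟩ := exists_equiv_mfderiv_symm x hy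
  obtain ⟨h1, h2⟩ := hb.pullback (w' := S.chartForms x y) L (by
    intro i u v
    rw [← hL, ← hL]
    change (S.form i _) _ = (S.form i _) _
    congr 1
    ext j
    fin_cases j <;> rfl)
  refine ⟨⟨_, h1⟩, ?_⟩
  ext u v
  rw [h2, ← hL, ← hL]
  rfl

lemma chartForms_self (x : M) : S.chartForms x (extChartAt (𝓡 4) x x) = S.at' x := by
  ext i v
  -- With the fixed codomain `V4` in place of tangent spaces, the base point can be rewritten
  -- without dependent types.
  have h1 : ∀ F : M → V4 [⋀^Fin 2]→L[ℝ] ℝ,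
      F ((extChartAt (𝓡 4) x).symm (extChartAt (𝓡 4) x x)) = F x := fun F => by
    rw [extChartAt_to_inv]
  have h2 := h1 (fun p => S.form i p)
  change (S.form i ((extChartAt (𝓡 4) x).symm (extChartAt (𝓡 4) x x)) : V4 [⋀^Fin 2]→L[ℝ] ℝ)
    (fun j => (mfderiv (𝓡 4) (𝓡 4) (extChartAt (𝓡 4) x).symm (extChartAt (𝓡 4) x x) :
      V4 →L[ℝ] V4) (v j)) = _
  rw [mfderiv_extChartAt_symm, h2]
  rfl

lemma nabla_eq (x : M) {Γ : V4 →ₗ[ℝ] V4 →ₗ[ℝ] V4}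
    (hΓ : ∀ v u, christoffel (S.metricInChart x) (extChartAt (𝓡 4) x x) v u = Γ v u)
    (i : Fin 3) (X : V4) (v : Fin 2 → V4) :
    S.nablaForm i x X v =
      covD (S.chartForms x) (extChartAt (𝓡 4) x x) Γ i X (v 0) (v 1) := by
  change (fun D : V4 →L[ℝ] V4 =>
    fderiv ℝ (inChart (S.form i) x) (extChartAt (𝓡 4) x x) (D X) ![D (v 0), D (v 1)]
    - inChart (S.form i) x (extChartAt (𝓡 4) x x)
      ![christoffel (S.metricInChart x) (extChartAt (𝓡 4) x x) (D X) (D (v 0)), D (v 1)]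
    - inChart (S.form i) x (extChartAt (𝓡 4) x x)
      ![D (v 0), christoffel (S.metricInChart x) (extChartAt (𝓡 4) x x) (D X) (D (v 1))])
    (mfderiv (𝓡 4) (𝓡 4) (extChartAt (𝓡 4) x) x : V4 →L[ℝ] V4) = _
  rw [mfderiv_extChartAt]
  simp only [covD, formBilin_apply, ← hΓ]
  rfl

lemma extD_eq (x : M) (i : Fin 3) :
    S.dForm i x =
      extDeriv (fun y => S.chartForms x y i) (extChartAt (𝓡 4) x x) := by
  have hD := mfderiv_extChartAt x
  ext v
  change extDeriv (fun y => S.chartForms x y i) (extChartAt (𝓡 4) x x)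
    (fun j => (mfderiv (𝓡 4) (𝓡 4) (extChartAt (𝓡 4) x) x : V4 →L[ℝ] V4) (v j)) = _
  rw [hD]
  rfl

lemma exists_torsion_at (x : M) : ∃ c : Fin 3 → V4 →ₗ[ℝ] ℝ,
    (∀ i (X : V4) (v : Fin 2 → V4), S.nablaForm i x X v =
      c (i + 2) X * formBilin (S.at' x (i + 1)) (v 0) (v 1)
        - c (i + 1) X * formBilin (S.at' x (i + 2)) (v 0) (v 1)) ∧
    ∀ i (X Y Z : V4), S.dForm i x ![X, Y, Z] =
      S.nablaForm i x X ![Y, Z] + S.nablaForm i x Y ![Z, X]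
        + S.nablaForm i x Z ![X, Y] := by
  have hA : ∀ᶠ y in 𝓝 (extChartAt (𝓡 4) x x), ∃ b, AdaptedFrame (S.chartForms x y) b := by
    filter_upwards [extChartAt_target_mem_nhds (I := 𝓡 4) x] with y hy
      using (S.chartForms_adapted x hy).1
  have hg : ∀ᶠ y in 𝓝 (extChartAt (𝓡 4) x x),
      S.metricInChart x y = metricOf (S.chartForms x y) := by
    filter_upwards [extChartAt_target_mem_nhds (I := 𝓡 4) x] with y hy
      using (S.chartForms_adapted x hy).2
  have hW := S.differentiableAt_chartForms x
  obtain ⟨Γ, hΓ, hsymm, hmet⟩ := exists_leviCivita hW hA hg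
  obtain ⟨c, hc⟩ := exists_torsion_forms hW hA hmet
  refine ⟨c, fun i X v => ?_, fun i X Y Z => ?_⟩
  · rw [S.nabla_eq x hΓ, hc, S.chartForms_self]
  · rw [S.extD_eq, extDeriv_eq_sum_covD hsymm, S.nabla_eq x hΓ, S.nabla_eq x hΓ,
      S.nabla_eq x hΓ]
    rfl

end SU2Structure

/-! ### Uniqueness and vanishing of the torsion coefficients -/

lemma AdaptedFrame.coeff_unique (hb : AdaptedFrame w b) {c d : Fin 3 → ℝ}
    (h : ∑ i, c i • w i = ∑ i, d i • w i) : c = d := by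
  have h' : ∀ q, formBilin (∑ i, c i • w i) (b 0) (b q) = formBilin (∑ i, d i • w i) (b 0) (b q) :=
    fun q => by rw [h]
  simp only [map_sum, map_smul, sum_apply, smul_apply, smul_eq_mul, hb _ _ _]
    at h'
  have h1 := h' 1
  have h2 := h' 2
  have h3 := h' 3
  simp [Fin.sum_univ_three, stdMat] at h1 h2 h3
  ext i
  fin_cases i <;> assumption

lemma AdaptedFrame.torsion_unique (hb : AdaptedFrame w b) {c d : Fin 3 → ℝ}
    (h : ∀ i u v, c (i + 2) * formBilin (w (i + 1)) u v - c (i + 1) * formBilin (w (i + 2)) u v =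
      d (i + 2) * formBilin (w (i + 1)) u v - d (i + 1) * formBilin (w (i + 2)) u v) : c = d := by
  have h1 := h 0 (b 0) (b 2)
  have h2 := h 1 (b 0) (b 3)
  have h3 := h 2 (b 0) (b 1)
  simp only [hb _ _ _] at h1 h2 h3
  simp [stdMat] at h1 h2 h3
  ext i
  fin_cases i <;> assumption

lemma AdaptedFrame.torsion_eq_zero_iff (hb : AdaptedFrame w b) (c : Fin 3 → ℝ) (i : Fin 3) :
    (∀ v : Fin 2 → V4, c (i + 2) * formBilin (w (i + 1)) (v 0) (v 1)
      - c (i + 1) * formBilin (w (i + 2)) (v 0) (v 1) = 0) ↔ c (i + 1) = 0 ∧ c (i + 2) = 0 := by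
  constructor
  · intro h
    have h1 := h ![b 0, b 1]
    have h2 := h ![b 0, b 2]
    have h3 := h ![b 0, b 3]
    simp only [Matrix.cons_val_zero, Matrix.cons_val_one, hb _ _ _] at h1 h2 h3
    fin_cases i <;> simp [stdMat] at h1 h2 h3 ⊢ <;> constructor <;> assumption
  · rintro ⟨h1, h2⟩ v
    simp [h1, h2]

/-- Existence and uniqueness of the intrinsic torsion at a point and in one direction: self-duality
puts `A` in the span of the `ω_i`, on which `A ↦ (A ⋄ ω_i)_i` is injective. -/
lemma AdaptedFrame.selfDual_diamond_iff (hb : AdaptedFrame w b) (c : Fin 3 → ℝ)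
    (A : V4 [⋀^Fin 2]→L[ℝ] ℝ) :
    ((∀ v, hodgeStar (k := 2) (l := 2) (metricOf w) (volOf w) A v = A v) ∧
      ∀ i v, c (i + 2) * formBilin (w (i + 1)) (v 0) (v 1)
        - c (i + 1) * formBilin (w (i + 2)) (v 0) (v 1) = diamond (metricOf w) A (w i) v) ↔
      A = ∑ i, c i • w i := by
  rw [hb.starTwo_eq_self_iff]
  constructor
  · rintro ⟨⟨d, rfl⟩, h⟩
    rw [hb.torsion_unique (c := c) (d := d)]
    intro i u v
    have := h i ![u, v]
    rw [hb.diamond_sum] at this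
    exact this
  · rintro rfl
    exact ⟨⟨c, rfl⟩, fun i v => (hb.diamond_sum c i v).symm⟩

lemma AdaptedFrame.innerForm_torsion (hb : AdaptedFrame w b) (c : Fin 3 → ℝ) {i : Fin 3}
    {N : (Fin 2 → V4) → ℝ} (hN : ∀ v, N v = c (i + 2) * formBilin (w (i + 1)) (v 0) (v 1)
      - c (i + 1) * formBilin (w (i + 2)) (v 0) (v 1)) :
    innerForm (metricOf w) N (w (i + 1)) = 2 * c (i + 2) := by
  have := hb.innerForm_sum
    (fun j => if j = i + 1 then c (i + 2) else if j = i + 2 then -c (i + 1) else 0) (N := N) (by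
      intro v
      rw [hN]
      fin_cases i <;> simp [Fin.sum_univ_three] <;> ring) (i + 1)
  simpa using this

end SUTwo

end

/-! ### The main theorem -/

open SUTwo

theorem mainTheorem11 {M : Type*} [TopologicalSpace M] [ChartedSpace SUTwo.V4 M]
    [IsManifold (𝓡 4) ∞ M] (S : SUTwo.SU2Structure M) :
    ∃ (T : (x : M) → TangentSpace (𝓡 4) x →L[ℝ] TangentSpace (𝓡 4) x [⋀^Fin 2]→L[ℝ] ℝ)
      (a : Fin 3 → (x : M) → TangentSpace (𝓡 4) x →L[ℝ] ℝ),
      -- `T` is the intrinsic torsion, and the `a i` are its components in the frame `ω`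
      (∀ T', S.IsIntrinsicTorsion T' ↔ T' = T) ∧
      (∀ a' : Fin 3 → (x : M) → TangentSpace (𝓡 4) x →L[ℝ] ℝ,
        (∀ x X, T x X = ∑ i, a' i x X • S.form i x) ↔ a' = a) ∧
      -- the torsion in terms of `∇ω`
      (∀ x X, T x X = (1 / 2 : ℝ) • (S.innerNabla 1 2 x X • S.form 0 x
        + S.innerNabla 2 0 x X • S.form 1 x + S.innerNabla 0 1 x X • S.form 2 x)) ∧
      (∀ i x X, a i x X = (1 / 2) * S.innerNabla (i + 1) (i + 2) x X) ∧
      -- the torsion forms in terms of `*dω`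
      (∀ x X, a 0 x X = -(1 / 2) * (S.starD 0 x X + S.JForm 1 (S.starD 2) x X
        - S.JForm 2 (S.starD 1) x X)) ∧
      (∀ x X, a 1 x X = -(1 / 2) * (S.starD 1 x X - S.JForm 0 (S.starD 2) x X
        + S.JForm 2 (S.starD 0) x X)) ∧
      (∀ x X, a 2 x X = -(1 / 2) * (S.starD 2 x X + S.JForm 0 (S.starD 1) x X
        - S.JForm 1 (S.starD 0) x X)) ∧
      -- the vanishing statements
      (∀ i, S.nabla (S.form i) = 0 ↔ a (i + 1) = 0 ∧ a (i + 2) = 0) ∧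
      (T = 0 ↔ ∀ i, S.nabla (S.form i) = 0) ∧
      ((∀ i, S.nabla (S.form i) = 0) ↔ ∀ i, SUTwo.extD (S.form i) = 0) := by
  choose c hc hd using S.exists_torsion_at
  choose b hb using S.exists_adaptedFrame_at
  let a : Fin 3 → (x : M) → TangentSpace (𝓡 4) x →L[ℝ] ℝ := fun i x =>
    (LinearMap.toContinuousLinearMap (c x i) : V4 →L[ℝ] ℝ)
  let T : (x : M) → TangentSpace (𝓡 4) x →L[ℝ] TangentSpace (𝓡 4) x [⋀^Fin 2]→L[ℝ] ℝ := fun x =>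
    ∑ i, (a i x).smulRight (S.form i x)
  have hTa : ∀ x X, T x X = ∑ i, a i x X • S.form i x := fun x X => by
    simp [T, sum_apply]
  have hinner : ∀ i x X, S.innerNabla (i + 1) (i + 2) x X = 2 * a i x X := by
    intro i x X
    have h := (hb x).innerForm_torsion (fun j => c x j X) (hc x (i + 1) X)
    have e1 : i + 1 + 1 = i + 2 := by fin_cases i <;> rfl
    have e2 : i + 1 + 2 = i := by fin_cases i <;> rfl
    rw [e1, e2] at h
    exact h
  have hstar := fun x => S.starD_eq (hc x) (hd x)
  have hnabla : ∀ i, S.nabla (S.form i) = 0 ↔ a (i + 1) = 0 ∧ a (i + 2) = 0 := by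
    intro i
    have h1 : S.nabla (S.form i) = 0 ↔ ∀ x (X : V4) (v : Fin 2 → V4), S.nablaForm i x X v = 0 :=
      ⟨fun h x X v => congrFun (congrFun (congrFun h x) X) v,
        fun h => funext fun x => funext fun X => funext fun v => h x X v⟩
    have h2 : ∀ j, a j = 0 ↔ ∀ x (X : V4), c x j X = 0 := fun j =>
      ⟨fun h x X => congrArg (fun f => f X) (congrFun h x),
        fun h => funext fun x => ContinuousLinearMap.ext fun X => h x X⟩
    rw [h1, h2, h2]
    simp only [hc]
    constructor
    · intro h
      have h3 := fun x X => ((hb x).torsion_eq_zero_iff (fun j => c x j X) i).1 (h x X)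
      exact ⟨fun x X => (h3 x X).1, fun x X => (h3 x X).2⟩
    · rintro ⟨h3, h4⟩ x X
      exact ((hb x).torsion_eq_zero_iff (fun j => c x j X) i).2 ⟨h3 x X, h4 x X⟩
  have ha0 : (∀ i, S.nabla (S.form i) = 0) ↔ a = 0 := by
    simp only [hnabla]
    constructor
    · intro h
      funext i
      fin_cases i
      · exact (h 1).2
      · exact (h 0).1
      · exact (h 0).2
    · rintro h i
      simp [h]
  have hJJ : ∀ x i (X : V4), cplx (S.at' x) i (cplx (S.at' x) i X) = -X :=
    fun x => (hb x).cplx_cplx_self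
  have ha1 : ∀ x X, a 0 x X = -(1 / 2) * (S.starD 0 x X + S.JForm 1 (S.starD 2) x X
        - S.JForm 2 (S.starD 1) x X) := by
    intro x (X : V4)
    have e1 : ∀ X : V4, cplx (S.at' x) 0 (cplx (S.at' x) 1 X) = cplx (S.at' x) 2 X :=
      (hb x).cplx_cplx_next 0
    have e2 : ∀ X : V4, cplx (S.at' x) 0 (cplx (S.at' x) 2 X) = -cplx (S.at' x) 1 X :=
      (hb x).cplx_next_cplx 2
    change c x 0 X = -(1 / 2) * (S.starD 0 x X + S.starD 2 x (cplx (S.at' x) 1 X)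
      - S.starD 1 x (cplx (S.at' x) 2 X))
    have h0 := hstar x 0 X
    -- Applying `J₂` to `*dω₃` and `J₃` to `*dω₂` produces `-a₁` and `a₁`; with the signs of the
    -- formula the `a₂` and `a₃` terms cancel, leaving `-2 a₁`. The other two formulas are
    -- analogous.
    have h1 := hstar x 2 (cplx (S.at' x) 1 X)
    have h2 := hstar x 1 (cplx (S.at' x) 2 X)
    simp [hJJ, e1, e2] at h0 h1 h2
    rw [h0, h1, h2]
    ring
  have ha2 : ∀ x X, a 1 x X = -(1 / 2) * (S.starD 1 x X - S.JForm 0 (S.starD 2) x X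
        + S.JForm 2 (S.starD 0) x X) := by
    intro x (X : V4)
    have e1 : ∀ X : V4, cplx (S.at' x) 1 (cplx (S.at' x) 0 X) = -cplx (S.at' x) 2 X :=
      (hb x).cplx_next_cplx 0
    have e2 : ∀ X : V4, cplx (S.at' x) 1 (cplx (S.at' x) 2 X) = cplx (S.at' x) 0 X :=
      (hb x).cplx_cplx_next 1
    change c x 1 X = -(1 / 2) * (S.starD 1 x X - S.starD 2 x (cplx (S.at' x) 0 X)
      + S.starD 0 x (cplx (S.at' x) 2 X))
    have h0 := hstar x 1 X
    have h1 := hstar x 2 (cplx (S.at' x) 0 X)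
    have h2 := hstar x 0 (cplx (S.at' x) 2 X)
    simp [hJJ, e1, e2] at h0 h1 h2
    rw [h0, h1, h2]
    ring
  have ha3 : ∀ x X, a 2 x X = -(1 / 2) * (S.starD 2 x X + S.JForm 0 (S.starD 1) x X
        - S.JForm 1 (S.starD 0) x X) := by
    intro x (X : V4)
    have e1 : ∀ X : V4, cplx (S.at' x) 2 (cplx (S.at' x) 0 X) = cplx (S.at' x) 1 X :=
      (hb x).cplx_cplx_next 2
    have e2 : ∀ X : V4, cplx (S.at' x) 2 (cplx (S.at' x) 1 X) = -cplx (S.at' x) 0 X :=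
      (hb x).cplx_next_cplx 1
    change c x 2 X = -(1 / 2) * (S.starD 2 x X + S.starD 1 x (cplx (S.at' x) 0 X)
      - S.starD 0 x (cplx (S.at' x) 1 X))
    have h0 := hstar x 2 X
    have h1 := hstar x 1 (cplx (S.at' x) 0 X)
    have h2 := hstar x 0 (cplx (S.at' x) 1 X)
    simp [hJJ, e1, e2] at h0 h1 h2
    rw [h0, h1, h2]
    ring
  have hTa' : ∀ a' : Fin 3 → (x : M) → TangentSpace (𝓡 4) x →L[ℝ] ℝ,
      (∀ x X, T x X = ∑ i, a' i x X • S.form i x) ↔ a' = a := by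
    intro a'
    constructor
    · intro h
      have h' : ∀ x X, (fun i => a' i x X) = fun i => a i x X := fun x X =>
        (hb x).coeff_unique ((h x X).symm.trans (hTa x X))
      funext i x
      ext X
      exact congrFun (h' x X) i
    · rintro rfl
      exact hTa
  refine ⟨T, a, ?_, hTa', ?_, ?_, ha1, ha2, ha3, hnabla, ?_, ?_⟩
  · intro T'
    have h1 := fun x (X : V4) (A : V4 [⋀^Fin 2]→L[ℝ] ℝ) =>
      (hb x).selfDual_diamond_iff (fun j => c x j X) A
    constructor
    · rintro ⟨h2, h3⟩
      funext x
      refine ContinuousLinearMap.ext fun X => ?_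
      refine ((h1 x X (T' x X)).1 ⟨h2 x X, fun i v => ?_⟩).trans (hTa x X).symm
      exact (hc x i X v).symm.trans (h3 i x X v)
    · rintro rfl
      have h2 := fun x (X : V4) => (h1 x X (T x X)).2 (hTa x X)
      exact ⟨fun x X => (h2 x X).1, fun i x X v => (hc x i X v).trans ((h2 x X).2 i v)⟩
  · intro x X
    have h0 := hinner 0 x X
    have h1 := hinner 1 x X
    have h2 := hinner 2 x X
    simp only [Fin.isValue, zero_add, Fin.reduceAdd] at h0 h1 h2
    rw [hTa, h0, h1, h2, Fin.sum_univ_three]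
    module
  · intro i x X
    rw [hinner]
    ring
  · rw [ha0]
    constructor
    · intro h
      exact ((hTa' 0).1 fun x X => by rw [h]; simp).symm
    · intro h
      funext x
      refine ContinuousLinearMap.ext fun X => ?_
      rw [hTa, h]
      simp
  · constructor
    · intro h i
      have h0 : ∀ x (X : V4) v, S.nablaForm i x X v = 0 := fun x X v =>
        congrFun (congrFun (congrFun (h i) x) X) v
      have h1 : ∀ x, S.dForm i x = 0 := by
        intro x
        ext v
        have hv : v = ![v 0, v 1, v 2] := by
          ext j; fin_cases j <;> rfl
        rw [hv, hd, h0, h0, h0]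
        simp
      exact funext h1
    · intro h
      rw [ha0]
      -- The torsion forms depend on the structure only through `*dω` and `J`, so closedness of the
      -- three forms kills them all.
      have hs : ∀ i x X, S.starD i x X = 0 := by
        intro i x X
        have h0 : S.dForm i x = 0 := congrFun (h i) x
        change hodgeStar (k := 3) (l := 1) (metricOf (S.at' x)) (volOf (S.at' x)) (S.dForm i x)
          ![X] = 0
        rw [h0]
        simp [hodgeStar, innerForm]
      funext i x
      refine ContinuousLinearMap.ext fun X => ?_
      fin_cases i
      · exact (ha1 x X).trans (by simp [SU2Structure.JForm, hs])
      · exact (ha2 x X).trans (by simp [SU2Structure.JForm, hs])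
      · exact (ha3 x X).trans (by simp [SU2Structure.JForm, hs])
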